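/- Let $H$ be a densely defined self-adjoint operator on a complex Hilbert space $\mathscr H$, with projection-valued measure $P^{(H)}$ (so $H=\int\lambda\,dP^{(H)}(\lambda)$) and form domain $\mathcal Q(H)$. Let $a,b\in\mathbb R$, and let $\mathcal E=\mathcal E[a,b]$ be the span of all eigenvectors of $H$ with eigenvalue in $[a,b]$; assume $\dim\mathcal E=m<\infty$, and let $\lambda_1\ge\dots\ge\lambda_m$ be the eigenvalues of $H$ in $\mathcal E$, counted with multiplicity. Let $v_1,\dots,v_m\in\mathcal Q(H)$, let $V:\mathbb C^m\to\mathscr H$, $Vx=\sum_i x_iv_i$, and let $N=P_{\mathcal E^\perp}V$. Let $\delta A,\delta B\in\mathbb C^{m\times m}$ be self-adjoint, and put $$A=V^\dagger HV+\delta A,\qquad B=V^\dagger V+\delta B,\qquad \mathcal N^{(B)}=N^\dagger N+\delta B,$$ where $V^\dagger HV$ is the matrix of the quadratic form of $H$ in the vectors $v_i$. Assume that $B$ is positive definite, and let $\tilde\lambda_1\ge\dots\ge\tilde\lambda_m$ be the eigenvalues of the generalized eigenvalue problem $Ax=\tilde\lambda Bx$, counted with multiplicity. For a self-adjoint $m\times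 m$ matrix $M$ write $\lambda_1(M)\ge\dots\ge\lambda_m(M)$ for its eigenvalues, $\lambda^*_{\min}(M)=\min\{\lambda_m(M),0\}$ and $\lambda^*_{\max}(M)=\max\{\lambda_1(M),0\}$. Assume: (i) the numerical range of $H$ is contained in $[E_{\min},E_{\max}]$, that is, $E_{\min}\|x\|^2\le (x,Hx)\le E_{\max}\|x\|^2$ for all $x$ in the domain of $H$; (ii) the problem is well-conditioned: $\lambda_m(B)>\lambda_1(\mathcal N^{(B)})$; (iii) the continuous part of the spectrum of $H$ has no support in $[a,b]$: if $(x,P^{(H)}(\{t\})x)=0$ for all $t\in\mathbb R$, then $(x,P^{(H)}([a,b])x)=0$. Put $N_<=N^\dagger P^{(H)}((-\infty,a))N$ and $N_>=N^\dagger P^{(H)}((b,\infty))N$, and let $\|\cdot\|$ be the operator norm. Then for every $i\in\{1,\dots,m\}$: if $\tilde\lambda_i\ge E_{\min}$ or $a\le E_{\min}$ (in particular, if $\tilde\lambda_i\ge a$), then $$\frac{(E_{\min}-\tilde\lambda_i)\|N_<\|+\lambda^*_{\min}(\delta A-\tilde\lambda_i\,\delta B)}{\lambda_m(B)-\lambda_1(\mathcal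 N^{(B)})}\le\tilde\lambda_i-\lambda_i;$$ if $\tilde\lambda_i\le E_{\max}$ or $b\ge E_{\max}$ (in particular, if $\tilde\lambda_i\le b$), then $$\tilde\lambda_i-\lambda_i\le\frac{(E_{\max}-\tilde\lambda_i)\|N_>\|+\lambda^*_{\max}(\delta A-\tilde\lambda_i\,\delta B)}{\lambda_m(B)-\lambda_1(\mathcal N^{(B)})}.$$ In particular, both inequalities hold for every $i$ with $\tilde\lambda_i\in[a,b]$ or $\tilde\lambda_i\in[E_{\min},E_{\max}]$. -/

import Mathlib

open MeasureTheory
open scoped InnerProductSpace ComplexOrder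

noncomputable section

/-- A projection-valued measure on the Borel sets of `ℝ`: orthogonal projections, total mass the
identity, countably additive in the strong operator topology. (Only the values on Borel sets
matter.) -/
structure ProjValuedMeasure (E : Type*) [NormedAddCommGroup E] [InnerProductSpace ℂ E]
    [CompleteSpace E] where
  proj : Set ℝ → E →L[ℂ] E
  isStarProjection : ∀ I, MeasurableSet I → IsStarProjection (proj I)
  proj_univ : proj Set.univ = 1
  hasSum_iUnion : ∀ f : ℕ → Set ℝ, (∀ k, MeasurableSet (f k)) →
    Pairwise (Function.onFun Disjoint f) →
    ∀ x, HasSum (fun k => proj (f k) x) (proj (⋃ k, f k) x)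

namespace ProjValuedMeasure

variable {E : Type*} [NormedAddCommGroup E] [InnerProductSpace ℂ E] [CompleteSpace E]

theorem proj_empty (P : ProjValuedMeasure E) : P.proj ∅ = 0 := by
  ext x
  have h := (P.hasSum_iUnion (fun _ => ∅) (fun _ => MeasurableSet.empty)
    (fun _ _ _ => by simp [Function.onFun]) x).summable
  simpa using (summable_const_iff (β := ℕ) _).mp h

theorem re_inner_nonneg (P : ProjValuedMeasure E) {I : Set ℝ} (hI : MeasurableSet I) (x : E) :
    0 ≤ (⟪x, P.proj I x⟫_ℂ).re := by
  have hp := P.isStarProjection I hI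
  have h1 : P.proj I (P.proj I x) = P.proj I x := by
    have := hp.isIdempotentElem
    exact congrArg (fun T : E →L[ℂ] E => T x) this
  have h2 : ⟪x, P.proj I x⟫_ℂ = ⟪P.proj I x, P.proj I x⟫_ℂ := by
    have hs := (ContinuousLinearMap.isSelfAdjoint_iff_isSymmetric.mp hp.isSelfAdjoint)
      x (P.proj I x)
    simp only [ContinuousLinearMap.coe_coe] at hs
    rw [hs, h1]
  rw [h2]
  exact inner_self_nonneg (𝕜 := ℂ)

/-- The scalar spectral measure `I ↦ ⟨x, P(I) x⟩` of a vector `x`. -/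
def scalarMeasure (P : ProjValuedMeasure E) (x : E) : Measure ℝ :=
  Measure.ofMeasurable (fun I _ => ENNReal.ofReal (⟪x, P.proj I x⟫_ℂ).re)
    (by simp [P.proj_empty])
    (by
      intro f hf hd
      have h := P.hasSum_iUnion f hf hd x
      have h2 : HasSum (fun k => (⟪x, P.proj (f k) x⟫_ℂ).re)
          (⟪x, P.proj (⋃ k, f k) x⟫_ℂ).re :=
        Complex.hasSum_re (h.mapL (innerSL ℂ x))
      rw [← h2.tsum_eq]
      exact ENNReal.ofReal_tsum_of_nonneg (fun k => P.re_inner_nonneg (hf k) x) h2.summable)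

open Classical in
/-- The projection-valued measure concentrated at `0` (that of the zero operator); it only serves
to show that projection-valued measures exist. -/
instance : Nonempty (ProjValuedMeasure E) :=
  ⟨{ proj := fun I => if (0 : ℝ) ∈ I then 1 else 0
     isStarProjection := by
       intro I _
       by_cases h : (0 : ℝ) ∈ I
       · simp [h]
       · simp [h]
     proj_univ := by simp
     hasSum_iUnion := by
       intro f _ hd x
       by_cases h : ∃ k, (0 : ℝ) ∈ f k
       · obtain ⟨k, hk⟩ := h
         have hU : (0 : ℝ) ∈ ⋃ k, f k := Set.mem_iUnion.mpr ⟨k, hk⟩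
         have hne : ∀ j, j ≠ k → (0 : ℝ) ∉ f j := fun j hj h0 =>
           Set.disjoint_left.mp (hd hj) h0 hk
         have := hasSum_single (f := fun j =>
           (if (0 : ℝ) ∈ f j then (1 : E →L[ℂ] E) else 0) x) k
           (fun j hj => by simp [hne j hj])
         simpa [hU, hk] using this
       · have hU : (0 : ℝ) ∉ ⋃ k, f k := by simpa using h
         have h' : ∀ k, (0 : ℝ) ∉ f k := by simpa using h
         simp only [h', hU, if_false, zero_apply]
         exact hasSum_zero }⟩

end ProjValuedMeasure

variable {E : Type*} [NormedAddCommGroup E] [InnerProductSpace ℂ E] [CompleteSpace E]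

/-- `H = ∫ t dP(t)`: the domain of `H` consists of the `x` with `∫ t² d⟨x, P(t) x⟩ < ∞`, and
`⟨x, H x⟩ = ∫ t d⟨x, P(t) x⟩` on it (by polarization this determines `H`). -/
def IsSpectralIntegral (H : E →ₗ.[ℂ] E) (P : ProjValuedMeasure E) : Prop :=
  (∀ x, x ∈ H.domain ↔ Integrable (fun t : ℝ => t ^ 2) (P.scalarMeasure x)) ∧
    ∀ x : H.domain, ⟪(x : E), H x⟫_ℂ = ((∫ t, t ∂(P.scalarMeasure (x : E)) : ℝ) : ℂ)

/-- The projection-valued measure `P^(H)` of a self-adjoint operator `H`: the one with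
`H = ∫ t dP(t)`, which exists and is unique (on Borel sets) by the spectral theorem. -/
def spectralPVM (H : E →ₗ.[ℂ] E) : ProjValuedMeasure E :=
  Classical.epsilon (IsSpectralIntegral H)

/-- The form domain `Q(H)`: all `x` with `∫ |t| d⟨x, P^(H)(t) x⟩ < ∞`. -/
def formDomain (H : E →ₗ.[ℂ] E) : Set E :=
  {x | Integrable (fun t : ℝ => t) ((spectralPVM H).scalarMeasure x)}

/-- The quadratic form `(x, H x) = ∫ t d⟨x, P^(H)(t) x⟩` on the form domain. -/
def quadForm (H : E →ₗ.[ℂ] E) (x : E) : ℝ :=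
  ∫ t, t ∂((spectralPVM H).scalarMeasure x)

/-- The sesquilinear form `(x, H y)` on the form domain, obtained from the quadratic form by
polarization (conjugate-linear in `x`). -/
def sesqForm (H : E →ₗ.[ℂ] E) (x y : E) : ℂ :=
  (((quadForm H (x + y) : ℝ) : ℂ) - ((quadForm H (x - y) : ℝ) : ℂ)
    + (((quadForm H (x - Complex.I • y) : ℝ) : ℂ)
      - ((quadForm H (x + Complex.I • y) : ℝ) : ℂ)) * Complex.I) / 4

/-- The band `ℰ[a,b]`: the span of all eigenvectors of `H` with eigenvalue in `[a,b]`. -/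
def bandSubspace (H : E →ₗ.[ℂ] E) (a b : ℝ) : Submodule ℂ E :=
  Submodule.span ℂ {x | ∃ hx : x ∈ H.domain, ∃ t ∈ Set.Icc a b, H ⟨x, hx⟩ = (t : ℂ) • x}

/-- The continuous part of the spectral measure of `H` does not charge `[a,b]`: whenever the scalar
spectral measure of `x` has no atoms (`x` lies in the continuous subspace of `H`), it vanishes
on `[a,b]`. -/
def NoContinuousSpectrumOn (H : E →ₗ.[ℂ] E) (a b : ℝ) : Prop :=
  ∀ x : E, (∀ t : ℝ, (spectralPVM H).scalarMeasure x {t} = 0) →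
    (spectralPVM H).scalarMeasure x (Set.Icc a b) = 0

/-- `lam 0 ≥ ⋯ ≥ lam (m-1)` are the eigenvalues of `H` in the subspace `K`, with multiplicity. -/
def IsEigenvaluesIn (H : E →ₗ.[ℂ] E) (K : Submodule ℂ E) {m : ℕ} (lam : Fin m → ℝ) : Prop :=
  Antitone lam ∧ ∃ e : Fin m → E, Orthonormal ℂ e ∧ Submodule.span ℂ (Set.range e) = K ∧
    ∀ i, ∃ hi : e i ∈ H.domain, H ⟨e i, hi⟩ = (lam i : ℂ) • e i

/-- `lam 0 ≥ ⋯ ≥ lam (m-1)` are the eigenvalues of the generalized eigenvalue problem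
`A b = lam B b`, with multiplicity. -/
def IsGenEigenvalues {m : ℕ} (A B : Matrix (Fin m) (Fin m) ℂ) (lam : Fin m → ℝ) : Prop :=
  Antitone lam ∧ ∃ c : Fin m → Fin m → ℂ, LinearIndependent ℂ c ∧
    ∀ i, A.mulVec (c i) = (lam i : ℂ) • B.mulVec (c i)

/-- The largest eigenvalue `λ₁(M)` of a Hermitian matrix. -/
def eigMax {m : ℕ} (M : Matrix (Fin m) (Fin m) ℂ) : ℝ := sSup (spectrum ℝ M)

/-- The smallest eigenvalue `λ_m(M)` of a Hermitian `m × m` matrix. -/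
def eigMin {m : ℕ} (M : Matrix (Fin m) (Fin m) ℂ) : ℝ := sInf (spectrum ℝ M)

/-- `λ*_max(M) = max {λ₁(M), 0}`. -/
def eigMaxStar {m : ℕ} (M : Matrix (Fin m) (Fin m) ℂ) : ℝ := max (eigMax M) 0

/-- `λ*_min(M) = min {λ_m(M), 0}`. -/
def eigMinStar {m : ℕ} (M : Matrix (Fin m) (Fin m) ℂ) : ℝ := min (eigMin M) 0

/-- The matrix `V† H V` of the form of `H` in the trial vectors (the columns of `V`). -/
def formMatrix (H : E →ₗ.[ℂ] E) {m : ℕ} (v : Fin m → E) : Matrix (Fin m) (Fin m) ℂ :=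
  Matrix.of fun i j => sesqForm H (v i) (v j)

/-- The matrix `N† P^(H)(I) N`, where `N` has the columns `n`. -/
def spectralMatrix (H : E →ₗ.[ℂ] E) {m : ℕ} (n : Fin m → E) (I : Set ℝ) :
    Matrix (Fin m) (Fin m) ℂ :=
  Matrix.of fun i j => ⟪n i, (spectralPVM H).proj I (n j)⟫_ℂ

/-- The columns of the noise map `N = P_{K^⊥} V`, where `V` has the columns `v`. -/
def noise (K : Submodule ℂ E) [K.HasOrthogonalProjection] {m : ℕ} (v : Fin m → E) : Fin m → E :=
  fun i => Kᗮ.starProjection (v i)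

/-- The norm of a matrix as an operator on Euclidean `ℂ^m`. -/
def matrixOpNorm {m : ℕ} (M : Matrix (Fin m) (Fin m) ℂ) : ℝ :=
  ‖Matrix.toEuclideanCLM (n := Fin m) (𝕜 := ℂ) M‖

end

/-! ### Self-adjoint operators with bounded numerical range -/

section BoundedNumericalRange

variable {E : Type*} [NormedAddCommGroup E] [InnerProductSpace ℂ E]

/-! The argument is a Courant–Fischer dimension count on the pencil `A - s B` with `s = lamT i`.
Split a trial vector as `V x = ∑ y_k e_k + n`, with `e_k` the band eigenvectors and `n` orthogonal
to the band. The band and its complement reduce the operator `T` that represents `H`, so the form of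
`A - s B` at `x` is `∑ (lam k - s) |y_k|²` plus a remainder: the form of `T - s` at `n`, plus that
of `δA - s δB` at `x`.

For the upper bound, choose `x ≠ 0` in the span of the first `i` generalized eigenvectors (counting
from 1) with its first `i - 1` band coordinates zero. The form is then nonnegative, while the band
sum is at most `(lam i - s) ‖y‖²`. Hence `(s - lam i) ‖y‖²` is at most the remainder. The lower
bound is the mirror image.

Two estimates finish. First, `‖y‖² = ‖V x‖² - ‖n‖²` is the form of `B - NB` at `x`, so it is at
least `(eigMin B - eigMax NB) ‖x‖²`. Second, `n` has no spectral mass in `[a,b]`: atoms there belong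
to the band, and continuous mass is excluded by hypothesis. So for `s ≥ a` only the mass above `b`
can make the form of `T - s` positive, by a factor of at most `Emax - s` (`inner_apply_sub_le`).

The measure `spectralPVM` is a choice, meaningful only once a representing measure exists. Bounded
numerical range makes `H` bounded, and the bounded spectral theorem is then derived from the
continuous functional calculus. -/

theorem LinearPMap.norm_apply_le_of_numericalRange {H : E →ₗ.[ℂ] E}
    (hdense : Dense (H.domain : Set E)) (hsymm : H.IsFormalAdjoint H) {M : ℝ} (hM : 0 < M)
    (hq : ∀ x : H.domain, |(⟪(x : E), H x⟫_ℂ).re| ≤ M * ‖(x : E)‖ ^ 2) (x : H.domain) :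
    ‖H x‖ ≤ M * ‖(x : E)‖ := by
  -- Polarization: by symmetry, `4 Re ⟪y, H x⟫` is the difference of the quadratic form at `x + y`
  -- and `x - y`; the parallelogram law bounds it.
  have hdom : ∀ y : H.domain,
      (⟪(y : E), H x⟫_ℂ).re ≤ M / 2 * (‖(x : E)‖ ^ 2 + ‖(y : E)‖ ^ 2) := by
    intro y
    have h1 := (abs_le.mp (hq (x + y))).2
    have h2 := (abs_le.mp (hq (x - y))).1
    have hs : (⟪(x : E), H y⟫_ℂ).re = (⟪(y : E), H x⟫_ℂ).re := by
      rw [← hsymm x y, ← inner_conj_symm, Complex.conj_re]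
    have hpar := parallelogram_law_with_norm ℂ (x : E) (y : E)
    simp only [LinearPMap.map_add, LinearPMap.map_sub, Submodule.coe_add, Submodule.coe_sub,
      inner_add_left, inner_add_right, inner_sub_left, inner_sub_right, Complex.add_re,
      Complex.sub_re] at h1 h2
    nlinarith
  have hall : ∀ y : E, (⟪y, H x⟫_ℂ).re ≤ M / 2 * (‖(x : E)‖ ^ 2 + ‖y‖ ^ 2) := by
    intro y
    refine hdense.induction (P := fun y : E =>
      (⟪y, H x⟫_ℂ).re ≤ M / 2 * (‖(x : E)‖ ^ 2 + ‖y‖ ^ 2)) (fun y hy => hdom ⟨y, hy⟩) ?_ y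
    exact isClosed_le (by fun_prop) (by fun_prop)
  -- The choice `y = M⁻¹ H x` balances the two squares, leaving `‖H x‖² ≤ (M ‖x‖)²`.
  have h := hall (((M⁻¹ : ℝ) : ℂ) • H x)
  rw [inner_smul_left, norm_smul, inner_self_eq_norm_sq_to_K] at h
  simp only [Complex.conj_ofReal, Complex.norm_real, Real.norm_eq_abs,
    abs_of_pos (inv_pos.mpr hM), Complex.coe_algebraMap] at h
  rw [← Complex.ofReal_pow, ← Complex.ofReal_mul, Complex.ofReal_re] at h
  refine abs_le_of_sq_le_sq' ?_ (by positivity) |>.2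
  have h3 : M * (M⁻¹ * ‖H x‖ ^ 2) ≤ M * (M / 2 * (‖(x : E)‖ ^ 2 + (M⁻¹ * ‖H x‖) ^ 2)) :=
    mul_le_mul_of_nonneg_left h hM.le
  have h4 : M * (M⁻¹ * ‖H x‖ ^ 2) = ‖H x‖ ^ 2 := by field_simp
  have h5 : M * (M / 2 * (‖(x : E)‖ ^ 2 + (M⁻¹ * ‖H x‖) ^ 2))
      = (M * ‖(x : E)‖) ^ 2 / 2 + ‖H x‖ ^ 2 / 2 := by field_simp
  rw [h4, h5] at h3
  linarith

variable [CompleteSpace E]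

/-- Boundedness makes `x ↦ ⟪y, H x⟫` continuous for every `y`, so every `y` lies in the domain of
the adjoint, which is `H` itself. -/
theorem LinearPMap.domain_eq_top_of_bounded {H : E →ₗ.[ℂ] E} (hH : IsSelfAdjoint H) {M : ℝ}
    (hb : ∀ x : H.domain, ‖H x‖ ≤ M * ‖(x : E)‖) : H.domain = ⊤ := by
  rw [Submodule.eq_top_iff']
  intro y
  have hH' : H.adjoint = H := LinearPMap.isSelfAdjoint_def.mp hH
  rw [← hH', LinearPMap.mem_adjoint_domain_iff]
  exact (innerSL ℂ y).continuous.comp (H.toFun.mkContinuous M hb).continuous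

/-- A self-adjoint operator with bounded numerical range is everywhere defined and bounded. -/
theorem LinearPMap.exists_clm_of_numericalRange {H : E →ₗ.[ℂ] E} (hH : IsSelfAdjoint H)
    {Emin Emax : ℝ}
    (hE : ∀ x : H.domain, Emin * ‖(x : E)‖ ^ 2 ≤ (⟪(x : E), H x⟫_ℂ).re ∧
      (⟪(x : E), H x⟫_ℂ).re ≤ Emax * ‖(x : E)‖ ^ 2) :
    ∃ T : E →L[ℂ] E, IsSelfAdjoint T ∧ H.domain = ⊤ ∧
      ∀ (x : E) (hx : x ∈ H.domain), H ⟨x, hx⟩ = T x := by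
  have hdense := hH.dense_domain
  have hsymm : H.IsFormalAdjoint H := by
    have h := LinearPMap.adjoint_isFormalAdjoint hdense
    rwa [LinearPMap.isSelfAdjoint_def.mp hH] at h
  have hb := LinearPMap.norm_apply_le_of_numericalRange hdense hsymm
    -- The summand 1 keeps the constant positive when both bounds vanish.
    (M := |Emin| + |Emax| + 1) (by positivity) (fun x => by
      obtain ⟨h1, h2⟩ := hE x
      have h0 := sq_nonneg ‖(x : E)‖
      rw [abs_le]
      constructor
      · nlinarith [neg_abs_le Emin, abs_nonneg Emax]
      · nlinarith [le_abs_self Emax, abs_nonneg Emin])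
  have htop := LinearPMap.domain_eq_top_of_bounded hH hb
  have hmem : ∀ x, x ∈ H.domain := fun x => htop ▸ Submodule.mem_top
  let L : E →ₗ[ℂ] E := H.toFun ∘ₗ LinearMap.codRestrict H.domain LinearMap.id hmem
  refine ⟨L.mkContinuous _ (fun x => hb ⟨x, hmem x⟩), ?_, htop, fun x hx => rfl⟩
  rw [ContinuousLinearMap.isSelfAdjoint_iff_isSymmetric]
  exact fun x y => hsymm ⟨x, hmem x⟩ ⟨y, hmem y⟩

end BoundedNumericalRange

/-! ### The spectral theorem for bounded self-adjoint operators -/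

section SpectralTheorem

variable {E : Type*} [NormedAddCommGroup E] [InnerProductSpace ℂ E] [CompleteSpace E]

open CompactlySupported in
-- The functional calculus is positive, so `f ↦ ⟪x, f(T) x⟫` is a positive functional on continuous
-- functions on the compact spectrum. Its Riesz measure is pushed forward to `ℝ`.
theorem ContinuousLinearMap.exists_spectralMeasure {T : E →L[ℂ] E} (hT : IsSelfAdjoint T) (x : E) :
    ∃ μ : Measure ℝ, IsFiniteMeasure μ ∧
      (∀ f : ℝ → ℝ, Continuous f → Integrable f μ) ∧
      ∀ f : ℝ → ℝ, Continuous f → ∫ t, f t ∂μ = (⟪x, cfc f T x⟫_ℂ).re := by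
  let K := spectrum ℝ T
  have : CompactSpace K := isCompact_iff_compactSpace.mp (spectrum.isCompact T)
  let Λ₀ : C_c(K, ℝ) →ₗ[ℝ] ℝ :=
    { toFun := fun f => (⟪x, cfcHom (R := ℝ) hT f.toContinuousMap x⟫_ℂ).re
      map_add' := fun f g => by
        have : (f + g).toContinuousMap = f.toContinuousMap + g.toContinuousMap := rfl
        simp [this]
      map_smul' := fun c f => by
        have : (c • f).toContinuousMap = c • f.toContinuousMap := rfl
        simp [this] }
  let Λ : C_c(K, ℝ) →ₚ[ℝ] ℝ := PositiveLinearMap.mk₀ Λ₀ (fun f hf => by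
    have h : 0 ≤ cfcHom (R := ℝ) hT f.toContinuousMap :=
      (cfcHom_nonneg_iff hT).mpr (fun t => hf t)
    rw [ContinuousLinearMap.nonneg_iff_isPositive] at h
    exact h.re_inner_nonneg_right x)
  have hint : ∀ f : ℝ → ℝ, Continuous f →
      Integrable f (Measure.map ((↑) : K → ℝ) (RealRMK.rieszMeasure Λ)) := by
    intro f hf
    rw [integrable_map_measure hf.aestronglyMeasurable measurable_subtype_coe.aemeasurable]
    exact (hf.comp continuous_subtype_val).integrable_of_hasCompactSupport
      (HasCompactSupport.of_compactSpace _)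
  refine ⟨Measure.map ((↑) : K → ℝ) (RealRMK.rieszMeasure Λ), inferInstance, hint, ?_⟩
  intro f hf
  rw [integral_map measurable_subtype_coe.aemeasurable hf.aestronglyMeasurable]
  let g : C_c(K, ℝ) := ⟨⟨fun t => f t, hf.comp continuous_subtype_val⟩,
    HasCompactSupport.of_compactSpace _⟩
  have h := RealRMK.integral_rieszMeasure Λ g
  refine h.trans ?_
  change (⟪x, cfcHom (R := ℝ) hT g.toContinuousMap x⟫_ℂ).re = _
  rw [cfc_apply f T hT hf.continuousOn]
  rfl

/-- Complex polarization turns the hypothesis into `S* S = S`; thus `S` is self-adjoint, and then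
idempotent. -/
theorem ContinuousLinearMap.isStarProjection_of_inner {S : E →L[ℂ] E}
    (h : ∀ x, ⟪S x, S x⟫_ℂ = ⟪x, S x⟫_ℂ) : IsStarProjection S := by
  have h1 : star S * S = S := by
    rw [ContinuousLinearMap.star_eq_adjoint]
    apply ContinuousLinearMap.coe_injective
    rw [← ext_inner_map]
    intro x
    have := congrArg (starRingEnd ℂ) (h x)
    rw [inner_conj_symm, inner_conj_symm] at this
    simpa [ContinuousLinearMap.adjoint_inner_left] using this
  have h2 : IsSelfAdjoint S := by
    rw [← h1]; exact IsSelfAdjoint.star_mul_self S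
  exact ⟨by rw [IsIdempotentElem]; nth_rw 1 [← h2.star_eq]; exact h1, h2⟩

theorem IsStarProjection.inner_apply_self {S : E →L[ℂ] E} (h : IsStarProjection S) (x : E) :
    ⟪x, S x⟫_ℂ = ((‖S x‖ ^ 2 : ℝ) : ℂ) := by
  have h1 : S (S x) = S x := congrArg (fun T : E →L[ℂ] E => T x) h.isIdempotentElem
  have hs : ⟪S x, S x⟫_ℂ = ⟪x, S (S x)⟫_ℂ :=
    (ContinuousLinearMap.isSelfAdjoint_iff_isSymmetric.mp h.isSelfAdjoint) x (S x)
  rw [h1] at hs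
  rw [← hs, inner_self_eq_norm_sq_to_K]
  simp

/-- `S` is an orthogonal projection whose quadratic form is `x ↦ μ x I`. -/
def IsProjOf (μ : E → Measure ℝ) (I : Set ℝ) (S : E →L[ℂ] E) : Prop :=
  IsStarProjection S ∧ ∀ x, ‖S x‖ ^ 2 = (μ x).real I

namespace IsProjOf

variable {μ : E → Measure ℝ} {I J : Set ℝ} {S S' : E →L[ℂ] E}

theorem unique (h : IsProjOf μ I S) (h' : IsProjOf μ I S') : S = S' := by
  apply ContinuousLinearMap.coe_injective
  rw [← ext_inner_map]
  intro x
  simp only [ContinuousLinearMap.coe_coe]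
  rw [← inner_conj_symm, ← inner_conj_symm (S' x)]
  rw [h.1.inner_apply_self, h'.1.inner_apply_self, h.2, h'.2]

theorem univ (hμ : ∀ x, (μ x).real Set.univ = ‖x‖ ^ 2) : IsProjOf μ Set.univ (1 : E →L[ℂ] E) :=
  ⟨IsStarProjection.one _, fun x => by simp [hμ]⟩

theorem compl [∀ x, IsFiniteMeasure (μ x)] (hμ : ∀ x, (μ x).real Set.univ = ‖x‖ ^ 2)
    (hI : MeasurableSet I) (h : IsProjOf μ I S) : IsProjOf μ Iᶜ (1 - S) := by
  refine ⟨h.1.one_sub, fun x => ?_⟩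
  rw [measureReal_compl hI, hμ, ← h.2]
  have h1 := h.1.one_sub.inner_apply_self x
  have h2 := h.1.inner_apply_self x
  have h3 : ⟪x, (1 - S) x⟫_ℂ = ⟪x, x⟫_ℂ - ⟪x, S x⟫_ℂ := by simp
  have h4 : ⟪x, x⟫_ℂ = ((‖x‖ ^ 2 : ℝ) : ℂ) := by simp [inner_self_eq_norm_sq_to_K]
  rw [h1, h2, h4] at h3
  exact_mod_cast h3

/-- The measure of `S x` has total mass `‖S x‖²`, and `I` already carries all of it; nothing is left
for the disjoint set `J`. -/
theorem apply_apply_eq_zero [∀ x, IsFiniteMeasure (μ x)]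
    (hμ : ∀ x, (μ x).real Set.univ = ‖x‖ ^ 2) (hJ : MeasurableSet J)
    (h : IsProjOf μ I S) (h' : IsProjOf μ J S') (hd : Disjoint I J) (x : E) : S' (S x) = 0 := by
  have hle : (μ (S x)).real I + (μ (S x)).real J ≤ ‖S x‖ ^ 2 := by
    rw [← hμ, ← measureReal_union hd hJ]
    exact measureReal_mono (Set.subset_univ _)
  have h1 : S (S x) = S x := congrArg (fun T : E →L[ℂ] E => T x) h.1.isIdempotentElem
  rw [← h.2, ← h'.2, h1] at hle
  have : ‖S' (S x)‖ ^ 2 = 0 := le_antisymm (by linarith) (sq_nonneg _)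
  simpa using this

/-- The ranges are mutually orthogonal and countable additivity makes `∑ ‖S k x‖²` converge, so the
projections sum strongly. Both `⟪x, S' x⟫` and `⟪S' x, S' x⟫` equal that sum. -/
theorem iUnion [∀ x, IsFiniteMeasure (μ x)] (hμ : ∀ x, (μ x).real Set.univ = ‖x‖ ^ 2)
    {f : ℕ → Set ℝ} (hf : ∀ k, MeasurableSet (f k)) (hd : Pairwise (Function.onFun Disjoint f))
    {S : ℕ → E →L[ℂ] E} (h : ∀ k, IsProjOf μ (f k) (S k)) :
    ∃ S' : E →L[ℂ] E, IsProjOf μ (⋃ k, f k) S' ∧ ∀ x, HasSum (fun k => S k x) (S' x) := by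
  have hnorm : ∀ x, HasSum (fun k => ‖S k x‖ ^ 2) ((μ x).real (⋃ k, f k)) := by
    intro x
    simp_rw [(h _).2 x]
    have h1 := ENNReal.hasSum_toReal (f := fun k => μ x (f k))
      (by rw [← measure_iUnion hd hf]; exact measure_ne_top _ _)
    rwa [← ENNReal.tsum_toReal_eq (fun k => measure_ne_top _ _), ← measure_iUnion hd hf] at h1
  have horth : ∀ x y i j, i ≠ j → ⟪S i x, S j y⟫_ℂ = 0 := by
    intro x y i j hij
    have hs : ⟪S j (S i x), y⟫_ℂ = ⟪S i x, S j y⟫_ℂ :=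
      (ContinuousLinearMap.isSelfAdjoint_iff_isSymmetric.mp (h j).1.isSelfAdjoint) _ _
    rw [← hs, (h i).apply_apply_eq_zero hμ (hf j) (h j) (hd hij), inner_zero_left]
  have hfam : OrthogonalFamily ℂ (fun k => (S k).range) (fun k => (S k).range.subtypeₗᵢ) := by
    rintro i j hij ⟨_, x, rfl⟩ ⟨_, y, rfl⟩
    exact horth x y i j hij
  have hsum : ∀ x, Summable (fun k => S k x) := fun x =>
    (hfam.summable_iff_norm_sq_summable (fun k => ⟨S k x, x, rfl⟩)).mpr (hnorm x).summable
  have htend : Filter.Tendsto (fun n x => (∑ k ∈ Finset.range n, S k) x) Filter.atTop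
      (nhds (fun x => ∑' k, S k x)) := by
    rw [tendsto_pi_nhds]
    intro x
    simpa using (hsum x).hasSum.tendsto_sum_nat
  let S' : E →L[ℂ] E := continuousLinearMapOfTendsto (fun n => ∑ k ∈ Finset.range n, S k) htend
  have hS' : ∀ x, HasSum (fun k => S k x) (S' x) := fun x => (hsum x).hasSum
  have hq : ∀ x, HasSum (fun k => ((‖S k x‖ ^ 2 : ℝ) : ℂ)) ⟪x, S' x⟫_ℂ := by
    intro x
    have := (hS' x).mapL (innerSL ℂ x)
    simpa [(h _).1.inner_apply_self] using this
  have hq' : ∀ x, HasSum (fun k => ((‖S k x‖ ^ 2 : ℝ) : ℂ)) ⟪S' x, S' x⟫_ℂ := by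
    intro x
    have h1 := (hS' x).mapL (innerSL ℂ (S' x))
    have h2 : ∀ k, ⟪S' x, S k x⟫_ℂ = ((‖S k x‖ ^ 2 : ℝ) : ℂ) := by
      intro k
      have h3 := (hS' x).mapL (innerSL ℂ (S k x))
      have h4 := h3.unique (hasSum_single k fun j hj => horth x x k j hj.symm)
      simp only [innerSL_apply_apply] at h4
      rw [← inner_conj_symm, h4, inner_self_eq_norm_sq_to_K]
      simp
    simpa [h2] using h1
  have hproj : IsStarProjection S' :=
    ContinuousLinearMap.isStarProjection_of_inner fun x => (hq' x).unique (hq x)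
  refine ⟨S', ⟨hproj, fun x => ?_⟩, hS'⟩
  have h1 := (hq x).unique (Complex.hasSum_ofReal.mpr (hnorm x))
  rw [hproj.inner_apply_self] at h1
  exact_mod_cast h1

end IsProjOf

/-- Continuous functions decreasing to the indicator of `F` give operators that converge strongly,
by dominated convergence. The limits of `∫ f_n` and `∫ f_n²` agree, which makes the limit a
projection. -/
theorem exists_isProjOf_of_isClosed {T : E →L[ℂ] E} (hT : IsSelfAdjoint T) {μ : E → Measure ℝ}
    [∀ x, IsFiniteMeasure (μ x)]
    (hμ : ∀ x (f : ℝ → ℝ), Continuous f → ∫ t, f t ∂μ x = (⟪x, cfc f T x⟫_ℂ).re)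
    {F : Set ℝ} (hF : IsClosed F) : ∃ S, IsProjOf μ F S := by
  have hδ : ∀ n : ℕ, 0 < 1 / ((n : ℝ) + 1) := fun n => Nat.one_div_pos_of_nat
  let f : ℕ → ℝ → ℝ := fun n t => (thickenedIndicator (hδ n) F t : ℝ)
  have hfc : ∀ n, Continuous (f n) := fun n =>
    NNReal.continuous_coe.comp (thickenedIndicator (hδ n) F).continuous
  have hf0 : ∀ n t, 0 ≤ f n t := fun n t => NNReal.coe_nonneg _
  have hf1 : ∀ n t, f n t ≤ 1 := fun n t =>
    NNReal.coe_le_one.mpr (thickenedIndicator_le_one (hδ n) F t)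
  have hlim : ∀ t, Filter.Tendsto (fun n => f n t) Filter.atTop
      (nhds (F.indicator (fun _ => (1 : ℝ)) t)) := by
    intro t
    have h := thickenedIndicator_tendsto_indicator_closure hδ
      tendsto_one_div_add_atTop_nhds_zero_nat F
    rw [tendsto_pi_nhds] at h
    have h2 := (NNReal.continuous_coe.tendsto _).comp (h t)
    rw [hF.closure_eq] at h2
    have h3 : F.indicator (fun _ => (1 : ℝ)) t =
        ((F.indicator (fun _ => (1 : NNReal)) t : NNReal) : ℝ) := by
      by_cases ht : t ∈ F <;> simp [ht]
    exact h3 ▸ h2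
  have hnorm : ∀ x (g : ℝ → ℝ), Continuous g → ‖cfc g T x‖ ^ 2 = ∫ t, g t ^ 2 ∂μ x := by
    intro x g hg
    have hs : ⟪cfc g T x, cfc g T x⟫_ℂ = ⟪x, cfc g T (cfc g T x)⟫_ℂ :=
      (ContinuousLinearMap.isSelfAdjoint_iff_isSymmetric.mp (cfc_predicate g T)) _ _
    rw [hμ x (fun t => g t ^ 2) (hg.pow 2), cfc_pow g 2 T hg.continuousOn, pow_two, pow_two,
      mul_apply_eq_comp, ← hs, inner_self_eq_norm_sq_to_K]
    simp [pow_two]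
  have hcau : ∀ x, CauchySeq (fun n => cfc (f n) T x) := by
    intro x
    rw [cauchySeq_iff_tendsto_dist_atTop_0]
    have h1 : Filter.Tendsto (fun p : ℕ × ℕ => ∫ t, (f p.1 t - f p.2 t) ^ 2 ∂μ x) Filter.atTop
        (nhds (∫ _, (0 : ℝ) ∂μ x)) := by
      refine tendsto_integral_filter_of_dominated_convergence (fun _ => 1)
        (.of_forall fun p => (((hfc p.1).sub (hfc p.2)).pow 2).aestronglyMeasurable)
        (.of_forall fun p => .of_forall fun t => ?_) (integrable_const _)
        (.of_forall fun t => ?_)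
      · rw [Real.norm_eq_abs, abs_of_nonneg (sq_nonneg _)]
        nlinarith [hf0 p.1 t, hf0 p.2 t, hf1 p.1 t, hf1 p.2 t]
      · rw [← Filter.prod_atTop_atTop_eq]
        have := ((hlim t).comp Filter.tendsto_fst).sub
          ((hlim t).comp (Filter.tendsto_snd (f := Filter.atTop (α := ℕ))))
        simpa using this.pow 2
    have h2 : ∀ p : ℕ × ℕ, dist (cfc (f p.1) T x) (cfc (f p.2) T x)
        = √(∫ t, (f p.1 t - f p.2 t) ^ 2 ∂μ x) := by
      intro p
      rw [← hnorm x (fun t => f p.1 t - f p.2 t) ((hfc p.1).sub (hfc p.2)),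
        Real.sqrt_sq (norm_nonneg _), dist_eq_norm,
        cfc_sub (f p.1) (f p.2) T (hfc p.1).continuousOn (hfc p.2).continuousOn,
        sub_apply]
    simp_rw [h2]
    have h3 := (Real.continuous_sqrt.tendsto _).comp h1
    rw [integral_zero, Real.sqrt_zero] at h3
    exact h3
  choose s hs using fun x => cauchySeq_tendsto_of_complete (hcau x)
  -- Banach–Steinhaus: a pointwise limit of bounded operators is bounded.
  let S : E →L[ℂ] E := continuousLinearMapOfTendsto (fun n => cfc (f n) T)
    (f := s) (tendsto_pi_nhds.mpr hs)
  have hS : ∀ x, Filter.Tendsto (fun n => cfc (f n) T x) Filter.atTop (nhds (S x)) := hs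
  have hlim1 : ∀ x, Filter.Tendsto (fun n => ⟪x, cfc (f n) T x⟫_ℂ) Filter.atTop
      (nhds (((μ x).real F : ℝ) : ℂ)) := by
    intro x
    have h1 : Filter.Tendsto (fun n => ∫ t, f n t ∂μ x) Filter.atTop (nhds ((μ x).real F)) := by
      rw [← integral_indicator_one hF.measurableSet]
      refine tendsto_integral_of_dominated_convergence (fun _ => 1)
        (fun n => (hfc n).aestronglyMeasurable) (integrable_const _)
        (fun n => .of_forall fun t => ?_) (.of_forall hlim)
      rw [Real.norm_eq_abs, abs_of_nonneg (hf0 n t)]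
      exact hf1 n t
    have h2 : ∀ n, ⟪x, cfc (f n) T x⟫_ℂ = ((∫ t, f n t ∂μ x : ℝ) : ℂ) := by
      intro n
      have hs : ⟪cfc (f n) T x, x⟫_ℂ = ⟪x, cfc (f n) T x⟫_ℂ :=
        (ContinuousLinearMap.isSelfAdjoint_iff_isSymmetric.mp (cfc_predicate (f n) T)) _ _
      rw [hμ x _ (hfc n)]
      exact (Complex.conj_eq_iff_re.mp (by rw [inner_conj_symm, hs])).symm
    simp_rw [h2]
    exact (Complex.continuous_ofReal.tendsto _).comp h1
  have hlim2 : ∀ x, Filter.Tendsto (fun n => ‖cfc (f n) T x‖ ^ 2) Filter.atTop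
      (nhds ((μ x).real F)) := by
    intro x
    simp_rw [hnorm x _ (hfc _)]
    rw [← integral_indicator_one hF.measurableSet]
    refine tendsto_integral_of_dominated_convergence (fun _ => 1)
      (fun n => ((hfc n).pow 2).aestronglyMeasurable) (integrable_const _)
      (fun n => .of_forall fun t => ?_) (.of_forall fun t => ?_)
    · rw [Real.norm_eq_abs, abs_of_nonneg (sq_nonneg _)]
      nlinarith [hf0 n t, hf1 n t]
    · have h := (hlim t).pow 2
      by_cases ht : t ∈ F <;> simpa [ht] using h
  have hSnorm : ∀ x, ‖S x‖ ^ 2 = (μ x).real F := fun x =>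
    tendsto_nhds_unique ((hS x).norm.pow 2) (hlim2 x)
  refine ⟨S, ContinuousLinearMap.isStarProjection_of_inner fun x => ?_, hSnorm⟩
  rw [tendsto_nhds_unique (tendsto_const_nhds.inner (hS x)) (hlim1 x), ← hSnorm,
    inner_self_eq_norm_sq_to_K]
  simp

/-- Closed sets form a π-system generating the Borel sets, and having a projection passes to
complements and countable disjoint unions. -/
theorem exists_isProjOf {T : E →L[ℂ] E} (hT : IsSelfAdjoint T) {μ : E → Measure ℝ}
    [∀ x, IsFiniteMeasure (μ x)]
    (hμ : ∀ x (f : ℝ → ℝ), Continuous f → ∫ t, f t ∂μ x = (⟪x, cfc f T x⟫_ℂ).re)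
    (hμ1 : ∀ x, (μ x).real Set.univ = ‖x‖ ^ 2)
    {I : Set ℝ} (hI : MeasurableSet I) : ∃ S, IsProjOf μ I S := by
  have hborel := (BorelSpace.measurable_eq (α := ℝ)).trans borel_eq_generateFrom_isClosed
  induction I, hI using MeasurableSpace.induction_on_inter hborel isPiSystem_isClosed with
  | empty => exact exists_isProjOf_of_isClosed hT hμ isClosed_empty
  | basic F hF => exact exists_isProjOf_of_isClosed hT hμ hF
  | compl I hI ih => exact ih.elim fun S hS => ⟨1 - S, hS.compl hμ1 hI⟩
  | iUnion f hd hf ih =>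
    choose S hS using ih
    obtain ⟨S', h, -⟩ := IsProjOf.iUnion hμ1 hf hd hS
    exact ⟨S', h⟩

/-- The spectral theorem for bounded self-adjoint operators. -/
theorem ContinuousLinearMap.exists_projValuedMeasure {T : E →L[ℂ] E} (hT : IsSelfAdjoint T) :
    ∃ P : ProjValuedMeasure E, ∀ x, Integrable (fun t : ℝ => t ^ 2) (P.scalarMeasure x) ∧
      ⟪x, T x⟫_ℂ = ((∫ t, t ∂(P.scalarMeasure x) : ℝ) : ℂ) := by
  classical
  choose μ hfin hint hμ using ContinuousLinearMap.exists_spectralMeasure hT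
  have hμ1 : ∀ x, (μ x).real Set.univ = ‖x‖ ^ 2 := by
    intro x
    have h := hμ x (fun _ => 1) continuous_const
    rw [cfc_const_one ℝ T] at h
    simpa [inner_self_eq_norm_sq_to_K, ← Complex.ofReal_pow] using h
  have hex : ∀ I : Set ℝ, ∃ S : E →L[ℂ] E, MeasurableSet I → IsProjOf μ I S := fun I => by
    by_cases hI : MeasurableSet I
    · exact (exists_isProjOf hT hμ hμ1 hI).imp fun S hS _ => hS
    · exact ⟨0, fun h => absurd h hI⟩
  choose S hS using hex
  let P : ProjValuedMeasure E :=
    { proj := S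
      isStarProjection := fun I hI => (hS I hI).1
      proj_univ := (hS _ MeasurableSet.univ).unique (IsProjOf.univ hμ1)
      hasSum_iUnion := fun f hf hd x => by
        obtain ⟨S', h1, h2⟩ := IsProjOf.iUnion hμ1 hf hd fun k => hS (f k) (hf k)
        rw [(hS _ (MeasurableSet.iUnion hf)).unique h1]
        exact h2 x }
  have hPμ : ∀ x, P.scalarMeasure x = μ x := by
    intro x
    ext I hI
    rw [ProjValuedMeasure.scalarMeasure, Measure.ofMeasurable_apply _ hI]
    change ENNReal.ofReal (⟪x, S I x⟫_ℂ).re = _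
    rw [(hS I hI).1.inner_apply_self, Complex.ofReal_re, (hS I hI).2]
    simp
  refine ⟨P, fun x => ?_⟩
  rw [hPμ x]
  refine ⟨hint x _ (by fun_prop), ?_⟩
  rw [hμ x (fun t => t) continuous_id, cfc_id' ℝ T]
  have hs : ⟪T x, x⟫_ℂ = ⟪x, T x⟫_ℂ :=
    (ContinuousLinearMap.isSelfAdjoint_iff_isSymmetric.mp hT) x x
  exact (Complex.conj_eq_iff_re.mp (by rw [inner_conj_symm, hs])).symm

end SpectralTheorem

/-! ### Calculus of spectral projections and the operator they represent -/

namespace ProjValuedMeasure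

variable {E : Type*} [NormedAddCommGroup E] [InnerProductSpace ℂ E] [CompleteSpace E]
variable (P : ProjValuedMeasure E)

theorem scalarMeasure_apply {I : Set ℝ} (hI : MeasurableSet I) (x : E) :
    P.scalarMeasure x I = ENNReal.ofReal (‖P.proj I x‖ ^ 2) := by
  rw [scalarMeasure, Measure.ofMeasurable_apply _ hI,
    (P.isStarProjection I hI).inner_apply_self, Complex.ofReal_re]

instance (x : E) : IsFiniteMeasure (P.scalarMeasure x) :=
  ⟨by rw [P.scalarMeasure_apply MeasurableSet.univ]; exact ENNReal.ofReal_lt_top⟩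

theorem scalarMeasure_real {I : Set ℝ} (hI : MeasurableSet I) (x : E) :
    (P.scalarMeasure x).real I = ‖P.proj I x‖ ^ 2 := by
  rw [measureReal_def, P.scalarMeasure_apply hI, ENNReal.toReal_ofReal (sq_nonneg _)]

theorem isProjOf {I : Set ℝ} (hI : MeasurableSet I) : IsProjOf P.scalarMeasure I (P.proj I) :=
  ⟨P.isStarProjection I hI, fun x => (P.scalarMeasure_real hI x).symm⟩

theorem scalarMeasure_real_univ (x : E) : (P.scalarMeasure x).real Set.univ = ‖x‖ ^ 2 := by
  simp [P.scalarMeasure_real MeasurableSet.univ, P.proj_univ]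

theorem inner_proj_left {I : Set ℝ} (hI : MeasurableSet I) (x y : E) :
    ⟪P.proj I x, y⟫_ℂ = ⟪x, P.proj I y⟫_ℂ :=
  (ContinuousLinearMap.isSelfAdjoint_iff_isSymmetric.mp (P.isStarProjection I hI).isSelfAdjoint)
    x y

theorem proj_proj_self {I : Set ℝ} (hI : MeasurableSet I) (x : E) :
    P.proj I (P.proj I x) = P.proj I x :=
  congrArg (fun T : E →L[ℂ] E => T x) (P.isStarProjection I hI).isIdempotentElem

theorem proj_proj_of_disjoint {I J : Set ℝ} (hI : MeasurableSet I) (hJ : MeasurableSet J)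
    (hd : Disjoint I J) (x : E) : P.proj J (P.proj I x) = 0 :=
  (P.isProjOf hI).apply_apply_eq_zero P.scalarMeasure_real_univ hJ (P.isProjOf hJ) hd x

theorem proj_union {I J : Set ℝ} (hI : MeasurableSet I) (hJ : MeasurableSet J)
    (hd : Disjoint I J) : P.proj (I ∪ J) = P.proj I + P.proj J := by
  apply ContinuousLinearMap.coe_injective
  rw [← ext_inner_map]
  intro x
  simp only [ContinuousLinearMap.coe_coe, add_apply, inner_add_left]
  rw [P.inner_proj_left hI, P.inner_proj_left hJ, P.inner_proj_left (hI.union hJ),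
    (P.isStarProjection I hI).inner_apply_self, (P.isStarProjection J hJ).inner_apply_self,
    (P.isStarProjection _ (hI.union hJ)).inner_apply_self, ← P.scalarMeasure_real hI,
    ← P.scalarMeasure_real hJ, ← P.scalarMeasure_real (hI.union hJ), measureReal_union hd hJ]
  simp

theorem proj_inter {I J : Set ℝ} (hI : MeasurableSet I) (hJ : MeasurableSet J) (x : E) :
    P.proj I (P.proj J x) = P.proj (I ∩ J) x := by
  have hIJ := hI.inter hJ
  have h1 : P.proj J = P.proj (I ∩ J) + P.proj (J \ I) := by
    rw [← P.proj_union hIJ (hJ.diff hI)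
      (Set.disjoint_of_subset_left Set.inter_subset_left Set.disjoint_sdiff_right),
      Set.inter_comm, Set.inter_union_sdiff]
  have h2 : P.proj I = P.proj (I ∩ J) + P.proj (I \ J) := by
    rw [← P.proj_union hIJ (hI.diff hJ)
      (Set.disjoint_of_subset_left Set.inter_subset_right Set.disjoint_sdiff_right),
      Set.inter_union_sdiff]
  have h3 : P.proj I (P.proj (I ∩ J) x) = P.proj (I ∩ J) x := by
    rw [h2, add_apply, P.proj_proj_self hIJ, P.proj_proj_of_disjoint hIJ (hI.diff hJ)
      (Set.disjoint_of_subset_left Set.inter_subset_right Set.disjoint_sdiff_right), add_zero]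
  rw [h1, add_apply, map_add, h3, P.proj_proj_of_disjoint (hJ.diff hI) hI Set.disjoint_sdiff_left,
    add_zero]

theorem proj_comm {I J : Set ℝ} (hI : MeasurableSet I) (hJ : MeasurableSet J) (x : E) :
    P.proj I (P.proj J x) = P.proj J (P.proj I x) := by
  rw [P.proj_inter hI hJ, P.proj_inter hJ hI, Set.inter_comm]

theorem scalarMeasure_proj {I : Set ℝ} (hI : MeasurableSet I) (x : E) :
    P.scalarMeasure (P.proj I x) = (P.scalarMeasure x).restrict I := by
  ext J hJ
  rw [Measure.restrict_apply hJ, P.scalarMeasure_apply hJ, P.scalarMeasure_apply (hJ.inter hI),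
    P.proj_inter hJ hI]

/-- Since `P(J)` commutes with `P(I)`, the vectors `P(J) x` and `P(J) y` are orthogonal for every
`J`. -/
theorem scalarMeasure_add {I : Set ℝ} (hI : MeasurableSet I) {x y : E} (hx : P.proj I x = x)
    (hy : P.proj I y = 0) :
    P.scalarMeasure (x + y) = P.scalarMeasure x + P.scalarMeasure y := by
  ext J hJ
  rw [Measure.add_apply, P.scalarMeasure_apply hJ, P.scalarMeasure_apply hJ,
    P.scalarMeasure_apply hJ, ← ENNReal.ofReal_add (sq_nonneg _) (sq_nonneg _), map_add]
  have h : ⟪P.proj J x, P.proj J y⟫_ℂ = 0 := by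
    rw [← hx, P.proj_comm hJ hI, P.inner_proj_left hI, P.proj_comm hI hJ, hy, map_zero,
      inner_zero_right]
  congr 1
  have := norm_add_sq_eq_norm_sq_add_norm_sq_of_inner_eq_zero _ _ h
  nlinarith

section Operator

variable {P} {T : E →L[ℂ] E}

/-- Spectral projections reduce the operator. -/
theorem comm_proj (hT : IsSelfAdjoint T)
    (hint : ∀ x, Integrable (fun t : ℝ => t) (P.scalarMeasure x))
    (hq : ∀ x, ⟪x, T x⟫_ℂ = ((∫ t, t ∂P.scalarMeasure x : ℝ) : ℂ))
    {I : Set ℝ} (hI : MeasurableSet I) (x : E) : T (P.proj I x) = P.proj I (T x) := by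
  have hsymm : ∀ x y, ⟪T x, y⟫_ℂ = ⟪x, T y⟫_ℂ :=
    ContinuousLinearMap.isSelfAdjoint_iff_isSymmetric.mp hT
  -- Additivity of the scalar measures makes the quadratic form additive on `x + y`, so the cross
  -- terms cancel. Replacing `y` by `i y` then removes the imaginary part.
  have hre : ∀ x y, P.proj I x = x → P.proj I y = 0 → (⟪x, T y⟫_ℂ).re = 0 := by
    intro x y hx hy
    have h1 := hq (x + y)
    rw [P.scalarMeasure_add hI hx hy, integral_add_measure (hint x) (hint y), Complex.ofReal_add,
      ← hq x, ← hq y, map_add, inner_add_left, inner_add_right, inner_add_right] at h1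
    have h2 : ⟪y, T x⟫_ℂ = (starRingEnd ℂ) ⟪x, T y⟫_ℂ := by
      rw [inner_conj_symm, hsymm]
    have h3 := congrArg Complex.re h1
    rw [h2] at h3
    simp only [Complex.add_re, Complex.conj_re] at h3
    linarith
  have hzero : ∀ x y, P.proj I x = x → P.proj I y = 0 → ⟪x, T y⟫_ℂ = 0 := by
    intro x y hx hy
    refine Complex.ext (hre x y hx hy) ?_
    have h := hre x (Complex.I • y) hx (by rw [map_smul, hy, smul_zero])
    rw [map_smul, inner_smul_right] at h
    simpa using h
  have hoff : ∀ w, P.proj I w = 0 → P.proj I (T w) = 0 := fun w hw => by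
    rw [← inner_self_eq_zero (𝕜 := ℂ), P.inner_proj_left hI, P.proj_proj_self hI,
      ← P.inner_proj_left hI]
    exact hzero _ _ (P.proj_proj_self hI _) hw
  have hker : P.proj I (x - P.proj I x) = 0 := by rw [map_sub, P.proj_proj_self hI, sub_self]
  have h1 : P.proj I (T x) = P.proj I (T (P.proj I x)) := by
    have := hoff _ hker
    rwa [map_sub, map_sub, sub_eq_zero] at this
  rw [h1, eq_comm, ← sub_eq_zero, ← inner_self_eq_zero (𝕜 := ℂ)]
  set u := P.proj I (T (P.proj I x)) - T (P.proj I x) with hu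
  have hPu : P.proj I u = 0 := by rw [hu, map_sub, P.proj_proj_self hI, sub_self]
  have h2 : ⟪P.proj I (T (P.proj I x)), u⟫_ℂ = 0 := by
    rw [P.inner_proj_left hI, hPu, inner_zero_right]
  have h3 : ⟪T (P.proj I x), u⟫_ℂ = 0 := by
    rw [hsymm]; exact hzero _ _ (P.proj_proj_self hI x) hPu
  nth_rw 1 [hu]
  rw [inner_sub_left, h2, h3, sub_zero]

/-- The scalar measure of `P({t}) z` sits at `t`, so `T P({t})` and `t P({t})` have the same
quadratic form. Thus atoms of the spectral measure yield eigenvectors. -/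
theorem apply_proj_singleton (hT : IsSelfAdjoint T)
    (hint : ∀ x, Integrable (fun t : ℝ => t) (P.scalarMeasure x))
    (hq : ∀ x, ⟪x, T x⟫_ℂ = ((∫ t, t ∂P.scalarMeasure x : ℝ) : ℂ))
    (t : ℝ) (x : E) : T (P.proj {t} x) = (t : ℂ) • P.proj {t} x := by
  have ht : MeasurableSet ({t} : Set ℝ) := measurableSet_singleton t
  have hsymm : ∀ x y, ⟪T x, y⟫_ℂ = ⟪x, T y⟫_ℂ :=
    ContinuousLinearMap.isSelfAdjoint_iff_isSymmetric.mp hT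
  have h : ((T * P.proj {t} : E →L[ℂ] E) : E →ₗ[ℂ] E)
      = (((t : ℂ) • P.proj {t} : E →L[ℂ] E) : E →ₗ[ℂ] E) := by
    rw [← ext_inner_map]
    intro z
    have h1 : ⟪T (P.proj {t} z), z⟫_ℂ = ((t * ‖P.proj {t} z‖ ^ 2 : ℝ) : ℂ) := by
      rw [← P.proj_proj_self ht z, comm_proj hT hint hq ht, P.inner_proj_left ht, hsymm, hq,
        P.scalarMeasure_proj ht, integral_singleton, P.scalarMeasure_real ht,
        P.proj_proj_self ht, smul_eq_mul, mul_comm]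
    have h2 : ⟪(t : ℂ) • P.proj {t} z, z⟫_ℂ = ((t * ‖P.proj {t} z‖ ^ 2 : ℝ) : ℂ) := by
      rw [inner_smul_left, P.inner_proj_left ht, (P.isStarProjection _ ht).inner_apply_self]
      simp
    exact h1.trans h2.symm
  exact congrArg (fun L : E →ₗ[ℂ] E => L x) h

/-- On the range of `P((M,∞))` the integral of `t - M > 0` is at most zero, which forces zero mass.
-/
theorem scalarMeasure_Ioi_eq_zero
    (hint : ∀ x, Integrable (fun t : ℝ => t) (P.scalarMeasure x))
    (hq : ∀ x, ⟪x, T x⟫_ℂ = ((∫ t, t ∂P.scalarMeasure x : ℝ) : ℂ))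
    {M : ℝ} (hM : ∀ x, (⟪x, T x⟫_ℂ).re ≤ M * ‖x‖ ^ 2) (x : E) :
    P.scalarMeasure x (Set.Ioi M) = 0 := by
  have h := hM (P.proj (Set.Ioi M) x)
  rw [hq, Complex.ofReal_re, ← P.scalarMeasure_real_univ, P.scalarMeasure_proj measurableSet_Ioi]
    at h
  set μ := (P.scalarMeasure x).restrict (Set.Ioi M) with hμ
  have hi : Integrable (fun t : ℝ => t - M) μ := (hint x).restrict.sub (integrable_const M)
  have hpos : ∀ᵐ t ∂μ, t ∈ Set.Ioi M := ae_restrict_mem measurableSet_Ioi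
  have h0 : ∫ t, (t - M) ∂μ = 0 := by
    refine le_antisymm ?_ (integral_nonneg_of_ae ?_)
    · rw [integral_sub (hint x).restrict (integrable_const M), integral_const, smul_eq_mul]
      linarith
    · filter_upwards [hpos] with t ht
      exact sub_nonneg.mpr (le_of_lt ht)
  rw [integral_eq_zero_iff_of_nonneg_ae (by
    filter_upwards [hpos] with t ht
    exact sub_nonneg.mpr (le_of_lt ht)) hi] at h0
  have hF : ∀ᵐ t ∂μ, False := by
    filter_upwards [h0, hpos] with t h1 h2
    have h1' : t - M = 0 := h1
    have h2' : M < t := h2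
    linarith
  rw [← Measure.restrict_eq_zero, ← hμ]
  simpa using hF

theorem scalarMeasure_Iio_eq_zero
    (hint : ∀ x, Integrable (fun t : ℝ => t) (P.scalarMeasure x))
    (hq : ∀ x, ⟪x, T x⟫_ℂ = ((∫ t, t ∂P.scalarMeasure x : ℝ) : ℂ))
    {M : ℝ} (hM : ∀ x, M * ‖x‖ ^ 2 ≤ (⟪x, T x⟫_ℂ).re) (x : E) :
    P.scalarMeasure x (Set.Iio M) = 0 := by
  have h := hM (P.proj (Set.Iio M) x)
  rw [hq, Complex.ofReal_re, ← P.scalarMeasure_real_univ, P.scalarMeasure_proj measurableSet_Iio]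
    at h
  set μ := (P.scalarMeasure x).restrict (Set.Iio M) with hμ
  have hi : Integrable (fun t : ℝ => M - t) μ := (integrable_const M).sub (hint x).restrict
  have hpos : ∀ᵐ t ∂μ, t ∈ Set.Iio M := ae_restrict_mem measurableSet_Iio
  have h0 : ∫ t, (M - t) ∂μ = 0 := by
    refine le_antisymm ?_ (integral_nonneg_of_ae ?_)
    · rw [integral_sub (integrable_const M) (hint x).restrict, integral_const, smul_eq_mul]
      linarith
    · filter_upwards [hpos] with t ht
      exact sub_nonneg.mpr (le_of_lt ht)
  rw [integral_eq_zero_iff_of_nonneg_ae (by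
    filter_upwards [hpos] with t ht
    exact sub_nonneg.mpr (le_of_lt ht)) hi] at h0
  have hF : ∀ᵐ t ∂μ, False := by
    filter_upwards [h0, hpos] with t h1 h2
    have h1' : M - t = 0 := h1
    have h2' : t < M := h2
    linarith
  rw [← Measure.restrict_eq_zero, ← hμ]
  simpa using hF

/-- Compare integrands: `t - s` is at most 0 for `t < a ≤ s`, and at most `M - s` for `b < t ≤ M`;
no other `t` carries mass. -/
theorem inner_apply_sub_le
    (hint : ∀ x, Integrable (fun t : ℝ => t) (P.scalarMeasure x))
    (hq : ∀ x, ⟪x, T x⟫_ℂ = ((∫ t, t ∂P.scalarMeasure x : ℝ) : ℂ))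
    {M : ℝ} (hM : ∀ x, (⟪x, T x⟫_ℂ).re ≤ M * ‖x‖ ^ 2) {a b s : ℝ} (hs : a ≤ s) {x : E}
    (hx : P.scalarMeasure x (Set.Icc a b) = 0) :
    (⟪x, T x⟫_ℂ).re - s * ‖x‖ ^ 2 ≤ (M - s) * ‖P.proj (Set.Ioi b) x‖ ^ 2 := by
  rw [hq, Complex.ofReal_re, ← P.scalarMeasure_real_univ, ← P.scalarMeasure_real measurableSet_Ioi]
  have h1 : ∫ t, t ∂P.scalarMeasure x - s * (P.scalarMeasure x).real Set.univ
      = ∫ t, (t - s) ∂P.scalarMeasure x := by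
    rw [integral_sub (hint x) (integrable_const s), integral_const, smul_eq_mul, mul_comm s]
  have h2 : (M - s) * (P.scalarMeasure x).real (Set.Ioi b)
      = ∫ t, (Set.Ioi b).indicator (fun _ => M - s) t ∂P.scalarMeasure x := by
    rw [integral_indicator_const _ measurableSet_Ioi, smul_eq_mul, mul_comm]
  rw [h1, h2]
  refine integral_mono_ae ((hint x).sub (integrable_const s))
    ((integrable_const _).indicator measurableSet_Ioi) ?_
  have hx' : ∀ᵐ t ∂P.scalarMeasure x, t ∉ Set.Icc a b := measure_eq_zero_iff_ae_notMem.mp hx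
  have hM' : ∀ᵐ t ∂P.scalarMeasure x, t ∉ Set.Ioi M :=
    measure_eq_zero_iff_ae_notMem.mp (scalarMeasure_Ioi_eq_zero hint hq hM x)
  filter_upwards [hx', hM'] with t h3 h4
  rw [Set.mem_Icc, not_and_or, not_le, not_le] at h3
  rw [Set.mem_Ioi, not_lt] at h4
  by_cases hb : b < t
  · rw [Set.indicator_of_mem (Set.mem_Ioi.mpr hb)]
    linarith
  · rw [Set.indicator_of_notMem (by simpa using hb)]
    rcases h3 with h3 | h3
    · linarith
    · exact absurd h3 hb

theorem le_inner_apply_sub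
    (hint : ∀ x, Integrable (fun t : ℝ => t) (P.scalarMeasure x))
    (hq : ∀ x, ⟪x, T x⟫_ℂ = ((∫ t, t ∂P.scalarMeasure x : ℝ) : ℂ))
    {M : ℝ} (hM : ∀ x, M * ‖x‖ ^ 2 ≤ (⟪x, T x⟫_ℂ).re) {a b s : ℝ} (hs : s ≤ b) {x : E}
    (hx : P.scalarMeasure x (Set.Icc a b) = 0) :
    (M - s) * ‖P.proj (Set.Iio a) x‖ ^ 2 ≤ (⟪x, T x⟫_ℂ).re - s * ‖x‖ ^ 2 := by
  rw [hq x, Complex.ofReal_re, ← P.scalarMeasure_real_univ x, ← P.scalarMeasure_real measurableSet_Iio]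
  have h1 : ∫ t, t ∂P.scalarMeasure x - s * (P.scalarMeasure x).real Set.univ
      = ∫ t, (t - s) ∂P.scalarMeasure x := by
    rw [integral_sub (hint x) (integrable_const s), integral_const, smul_eq_mul, mul_comm s]
  have h2 : (M - s) * (P.scalarMeasure x).real (Set.Iio a)
      = ∫ t, (Set.Iio a).indicator (fun _ => M - s) t ∂P.scalarMeasure x := by
    rw [integral_indicator_const _ measurableSet_Iio, smul_eq_mul, mul_comm]
  rw [h1, h2]
  refine integral_mono_ae ((integrable_const _).indicator measurableSet_Iio)
    ((hint x).sub (integrable_const s)) ?_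
  have hx' : ∀ᵐ t ∂P.scalarMeasure x, t ∉ Set.Icc a b := measure_eq_zero_iff_ae_notMem.mp hx
  have hM' : ∀ᵐ t ∂P.scalarMeasure x, t ∉ Set.Iio M :=
    measure_eq_zero_iff_ae_notMem.mp (scalarMeasure_Iio_eq_zero hint hq hM x)
  filter_upwards [hx', hM'] with t h3 h4
  rw [Set.mem_Icc, not_and_or, not_le, not_le] at h3
  rw [Set.mem_Iio, not_lt] at h4
  by_cases ha : t < a
  · rw [Set.indicator_of_mem (Set.mem_Iio.mpr ha)]
    linarith
  · rw [Set.indicator_of_notMem (by simpa using ha)]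
    rcases h3 with h3 | h3
    · exact absurd h3 ha
    · linarith

end Operator

end ProjValuedMeasure

/-! ### Hermitian pencils and dimension counting -/

section Matrices

open Matrix

variable {m : ℕ}

theorem star_dotProduct_mulVec_sum (M : Matrix (Fin m) (Fin m) ℂ) (c : Fin m → Fin m → ℂ)
    (z : Fin m → ℂ) :
    star (∑ k, z k • c k) ⬝ᵥ M *ᵥ (∑ j, z j • c j)
      = ∑ k, ∑ j, star (z k) * z j * (star (c k) ⬝ᵥ M *ᵥ c j) := by
  simp only [star_sum, star_smul, Matrix.mulVec_sum, Matrix.mulVec_smul, sum_dotProduct,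
    dotProduct_sum, smul_dotProduct, dotProduct_smul, smul_eq_mul]
  simp only [Finset.mul_sum]
  rw [Finset.sum_comm]
  exact Finset.sum_congr rfl fun k _ => Finset.sum_congr rfl fun j _ => by ring

/-- The form `A - s B` is nonnegative on combinations of generalized eigenvectors whose
eigenvalues are at least `s`. -/
theorem re_dotProduct_nonneg_of_genEigenvectors {A B : Matrix (Fin m) (Fin m) ℂ}
    (hA : A.IsHermitian) (hB : B.PosSemidef) {c : Fin m → Fin m → ℂ} {l : Fin m → ℝ}
    (hc : ∀ i, A *ᵥ c i = (l i : ℂ) • B *ᵥ c i) {s : ℝ} {z : Fin m → ℂ}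
    (hz : ∀ j, z j ≠ 0 → s ≤ l j) :
    0 ≤ (star (∑ k, z k • c k) ⬝ᵥ (A - (s : ℂ) • B) *ᵥ (∑ j, z j • c j)).re := by
  -- The vectors `c k` need not be `B`-orthogonal within an eigenspace; Hermiticity gives
  -- orthogonality only across distinct eigenvalues.
  have hG : ∀ k j, (l j : ℂ) * (star (c k) ⬝ᵥ B *ᵥ c j) = l k * (star (c k) ⬝ᵥ B *ᵥ c j) := by
    intro k j
    have h1 : star (c k) ⬝ᵥ A *ᵥ c j = (l j : ℂ) * (star (c k) ⬝ᵥ B *ᵥ c j) := by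
      rw [hc, dotProduct_smul, smul_eq_mul]
    have h2 : star (c k) ⬝ᵥ A *ᵥ c j = (l k : ℂ) * (star (c k) ⬝ᵥ B *ᵥ c j) := by
      rw [dotProduct_mulVec, ← hA.eq, ← star_mulVec, hc, star_smul, smul_dotProduct, star_mulVec,
        hB.isHermitian.eq, ← dotProduct_mulVec]
      simp
    rw [← h1, h2]
  -- Rescaling each coefficient by `√(l k - s)` absorbs the shift, since the surviving cross terms
  -- have `l k = l j`. What remains is a value of the nonnegative form `B`.
  have key : star (∑ k, z k • c k) ⬝ᵥ (A - (s : ℂ) • B) *ᵥ (∑ j, z j • c j)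
      = star (∑ k, ((√(l k - s) : ℂ) * z k) • c k) ⬝ᵥ B *ᵥ
        (∑ j, ((√(l j - s) : ℂ) * z j) • c j) := by
    rw [star_dotProduct_mulVec_sum, star_dotProduct_mulVec_sum]
    refine Finset.sum_congr rfl fun k _ => Finset.sum_congr rfl fun j _ => ?_
    have h1 : star (c k) ⬝ᵥ (A - (s : ℂ) • B) *ᵥ c j
        = ((l j : ℂ) - s) * (star (c k) ⬝ᵥ B *ᵥ c j) := by
      rw [sub_mulVec, hc, smul_mulVec, ← sub_smul, dotProduct_smul, smul_eq_mul]
    rw [h1]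
    by_cases hG0 : star (c k) ⬝ᵥ B *ᵥ c j = 0
    · simp [hG0]
    by_cases hzj : z j = 0
    · simp [hzj]
    have hl : l j = l k := by exact_mod_cast mul_right_cancel₀ hG0 (hG k j)
    have hs : (√(l j - s) : ℂ) * (√(l j - s) : ℂ) = (l j : ℂ) - s := by
      rw [← Complex.ofReal_mul, Real.mul_self_sqrt (sub_nonneg.mpr (hz j hzj))]
      simp
    rw [← hl, ← hs, star_mul']
    have h2 : star (√(l j - s) : ℂ) = (√(l j - s) : ℂ) := Complex.conj_ofReal _
    rw [h2]
    ring
  rw [key]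
  exact (Complex.le_def.mp (hB.dotProduct_mulVec_nonneg _)).1

theorem re_dotProduct_nonpos_of_genEigenvectors {A B : Matrix (Fin m) (Fin m) ℂ}
    (hA : A.IsHermitian) (hB : B.PosSemidef) {c : Fin m → Fin m → ℂ} {l : Fin m → ℝ}
    (hc : ∀ i, A *ᵥ c i = (l i : ℂ) • B *ᵥ c i) {s : ℝ} {z : Fin m → ℂ}
    (hz : ∀ j, z j ≠ 0 → l j ≤ s) :
    (star (∑ k, z k • c k) ⬝ᵥ (A - (s : ℂ) • B) *ᵥ (∑ j, z j • c j)).re ≤ 0 := by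
  have h := re_dotProduct_nonneg_of_genEigenvectors hA.neg hB (l := fun j => -l j) (c := c)
    (fun i => by rw [neg_mulVec, hc]; simp) (s := -s) (z := z)
    (fun j hj => neg_le_neg (hz j hj))
  have h1 : -A - ((-s : ℝ) : ℂ) • B = -(A - (s : ℂ) • B) := by
    push_cast
    rw [neg_smul]
    abel
  rw [h1, neg_mulVec, dotProduct_neg, Complex.neg_re] at h
  linarith

/-- Restricting to coefficients supported on `J` leaves fewer equations than unknowns; independence
of `c` keeps the resulting vector nonzero. -/
theorem exists_combination_of_card_lt {c : Fin m → Fin m → ℂ} (hc : LinearIndependent ℂ c)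
    (y : (Fin m → ℂ) →ₗ[ℂ] (Fin m → ℂ)) {J K : Finset (Fin m)} (h : K.card < J.card) :
    ∃ z : Fin m → ℂ, (∀ j, z j ≠ 0 → j ∈ J) ∧ ∑ j, z j • c j ≠ 0 ∧
      ∀ k ∈ K, y (∑ j, z j • c j) k = 0 := by
  classical
  let L : (Fin m → ℂ) →ₗ[ℂ] (Fin m → ℂ) := Fintype.linearCombination ℂ c
  let incl : (J → ℂ) →ₗ[ℂ] (Fin m → ℂ) := Function.ExtendByZero.linearMap ℂ ((↑) : J → Fin m)
  let F : (J → ℂ) →ₗ[ℂ] (K → ℂ) :=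
    LinearMap.funLeft ℂ ℂ ((↑) : K → Fin m) ∘ₗ y ∘ₗ L ∘ₗ incl
  obtain ⟨w, hw, hw0⟩ := (Submodule.ne_bot_iff _).mp
    (LinearMap.ker_ne_bot_of_finrank_lt (f := F) (by simpa using h))
  have hincl : ∀ j : J, incl w j = w j := fun j => Subtype.val_injective.extend_apply _ _ _
  refine ⟨incl w, fun j hj => ?_, fun h0 => hw0 ?_, fun k hk => ?_⟩
  · by_contra hjJ
    exact hj (Function.extend_apply' _ _ _ (by rintro ⟨a, rfl⟩; exact hjJ a.2))
  · have := Fintype.linearIndependent_iff.mp hc _ h0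
    ext j
    rw [← hincl, this]
    rfl
  · exact congrFun (LinearMap.mem_ker.mp hw) ⟨k, hk⟩

theorem re_star_dotProduct_self (x : Fin m → ℂ) : (star x ⬝ᵥ x).re = ∑ i, ‖x i‖ ^ 2 := by
  simp only [dotProduct, Complex.re_sum, Pi.star_apply]
  refine Finset.sum_congr rfl fun i _ => ?_
  rw [← Complex.normSq_eq_norm_sq, Complex.star_def, ← Complex.normSq_eq_conj_mul_self,
    Complex.ofReal_re]

open scoped MatrixOrder in
theorem re_dotProduct_mulVec_le_eigMax {M : Matrix (Fin m) (Fin m) ℂ} (hM : M.IsHermitian)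
    (x : Fin m → ℂ) : (star x ⬝ᵥ M *ᵥ x).re ≤ eigMax M * ∑ i, ‖x i‖ ^ 2 := by
  have hps : ((algebraMap ℝ (Matrix (Fin m) (Fin m) ℂ) (eigMax M)) - M).PosSemidef := by
    rw [← Matrix.le_iff, le_algebraMap_iff_spectrum_le hM.isSelfAdjoint]
    refine fun t ht => le_csSup ?_ ht
    rw [hM.spectrum_real_eq_range_eigenvalues]
    exact (Set.finite_range _).bddAbove
  have h := (Complex.le_def.mp (hps.dotProduct_mulVec_nonneg x)).1
  rw [sub_mulVec, dotProduct_sub, Algebra.algebraMap_eq_smul_one, smul_mulVec, one_mulVec,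
    dotProduct_smul, Complex.sub_re, Complex.real_smul, Complex.re_ofReal_mul,
    re_star_dotProduct_self, Complex.zero_re] at h
  linarith

open scoped MatrixOrder in
theorem eigMin_le_re_dotProduct_mulVec {M : Matrix (Fin m) (Fin m) ℂ} (hM : M.IsHermitian)
    (x : Fin m → ℂ) : eigMin M * ∑ i, ‖x i‖ ^ 2 ≤ (star x ⬝ᵥ M *ᵥ x).re := by
  have hps : (M - (algebraMap ℝ (Matrix (Fin m) (Fin m) ℂ) (eigMin M))).PosSemidef := by
    rw [← Matrix.le_iff, algebraMap_le_iff_le_spectrum hM.isSelfAdjoint]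
    refine fun t ht => csInf_le ?_ ht
    rw [hM.spectrum_real_eq_range_eigenvalues]
    exact (Set.finite_range _).bddBelow
  have h := (Complex.le_def.mp (hps.dotProduct_mulVec_nonneg x)).1
  rw [sub_mulVec, dotProduct_sub, Algebra.algebraMap_eq_smul_one, smul_mulVec, one_mulVec,
    dotProduct_smul, Complex.sub_re, Complex.real_smul, Complex.re_ofReal_mul,
    re_star_dotProduct_self, Complex.zero_re] at h
  linarith

theorem re_dotProduct_mulVec_le_matrixOpNorm (M : Matrix (Fin m) (Fin m) ℂ)
    (x : Fin m → ℂ) : (star x ⬝ᵥ M *ᵥ x).re ≤ matrixOpNorm M * ∑ i, ‖x i‖ ^ 2 := by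
  let X : EuclideanSpace ℂ (Fin m) := WithLp.toLp 2 x
  have h1 : star x ⬝ᵥ M *ᵥ x = ⟪X, Matrix.toEuclideanCLM (n := Fin m) (𝕜 := ℂ) M X⟫_ℂ := by
    rw [EuclideanSpace.inner_eq_star_dotProduct, dotProduct_comm]
    simp [X]
  have h2 : ∑ i, ‖x i‖ ^ 2 = ‖X‖ ^ 2 := by rw [EuclideanSpace.norm_sq_eq]
  rw [h1, h2]
  calc _ ≤ ‖⟪X, Matrix.toEuclideanCLM (n := Fin m) (𝕜 := ℂ) M X⟫_ℂ‖ := Complex.re_le_norm _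
    _ ≤ ‖X‖ * ‖Matrix.toEuclideanCLM (n := Fin m) (𝕜 := ℂ) M X‖ := norm_inner_le_norm _ _
    _ ≤ ‖X‖ * (matrixOpNorm M * ‖X‖) := by
      gcongr
      exact ContinuousLinearMap.le_opNorm _ _
    _ = _ := by ring

end Matrices

/-! ### Splitting the form into band and noise contributions -/

section Decomposition

variable {E : Type*} [NormedAddCommGroup E] [InnerProductSpace ℂ E] {m : ℕ}

open Matrix in
theorem star_dotProduct_of_inner_mulVec (L : E →ₗ[ℂ] E) (v : Fin m → E) (x : Fin m → ℂ) :
    star x ⬝ᵥ (Matrix.of fun i j => ⟪v i, L (v j)⟫_ℂ) *ᵥ x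
      = ⟪∑ i, x i • v i, L (∑ i, x i • v i)⟫_ℂ := by
  simp only [map_sum, map_smul, sum_inner, inner_sum, inner_smul_left, inner_smul_right,
    dotProduct, mulVec, Matrix.of_apply, Finset.mul_sum, Pi.star_apply]
  rw [Finset.sum_comm]
  exact Finset.sum_congr rfl fun i _ => Finset.sum_congr rfl fun j _ => by
    rw [starRingEnd_apply]; ring

theorem Orthonormal.norm_sum_add_sq {e : Fin m → E} (he : Orthonormal ℂ e) (y : Fin m → ℂ) {n : E}
    (hn : ∀ k, ⟪e k, n⟫_ℂ = 0) :
    ‖∑ k, y k • e k + n‖ ^ 2 = ∑ k, ‖y k‖ ^ 2 + ‖n‖ ^ 2 := by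
  have h : ⟪∑ k, y k • e k, n⟫_ℂ = 0 := by simp [hn]
  have h1 := norm_add_sq_eq_norm_sq_add_norm_sq_of_inner_eq_zero _ _ h
  have h2 : ‖∑ k, y k • e k‖ ^ 2 = ∑ k, ‖y k‖ ^ 2 := by
    have := he.inner_sum y y Finset.univ
    rw [inner_self_eq_norm_sq_to_K] at this
    have h3 := congrArg Complex.re this
    simpa [← Complex.normSq_eq_norm_sq, ← Complex.normSq_eq_conj_mul_self, ← Complex.ofReal_pow]
      using h3
  nlinarith

theorem Orthonormal.re_inner_apply_sum_add {T : E →ₗ[ℂ] E} (hT : T.IsSymmetric) {e : Fin m → E}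
    (he : Orthonormal ℂ e) {l : Fin m → ℝ} (hl : ∀ k, T (e k) = (l k : ℂ) • e k)
    (y : Fin m → ℂ) {n : E} (hn : ∀ k, ⟪e k, n⟫_ℂ = 0) :
    (⟪∑ k, y k • e k + n, T (∑ k, y k • e k + n)⟫_ℂ).re
      = ∑ k, l k * ‖y k‖ ^ 2 + (⟪n, T n⟫_ℂ).re := by
  have hTu : T (∑ k, y k • e k) = ∑ k, (l k * y k) • e k := by
    simp only [map_sum, map_smul, hl, smul_smul, mul_comm]
  have h1 : ⟪T (∑ k, y k • e k), n⟫_ℂ = 0 := by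
    simp [hTu, hn]
  have h2 : ⟪∑ k, y k • e k, T n⟫_ℂ = 0 := by rw [← hT, h1]
  have h3 : ⟪n, T (∑ k, y k • e k)⟫_ℂ = 0 := by rw [← inner_conj_symm, h1, map_zero]
  rw [map_add, inner_add_left, inner_add_right, inner_add_right, h2, h3, hTu,
    he.inner_sum y _ Finset.univ, zero_add, add_zero, Complex.add_re, Complex.re_sum]
  congr 1
  refine Finset.sum_congr rfl fun k _ => ?_
  rw [← Complex.normSq_eq_norm_sq, mul_left_comm, ← Complex.normSq_eq_conj_mul_self,
    ← Complex.ofReal_mul, Complex.ofReal_re]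

end Decomposition

theorem mem_bandSubspace {E : Type*} [NormedAddCommGroup E] [InnerProductSpace ℂ E]
    {H : E →ₗ.[ℂ] E} {T : E →L[ℂ] E} (htop : H.domain = ⊤)
    (hHT : ∀ (x : E) (hx : x ∈ H.domain), H ⟨x, hx⟩ = T x) {a b t : ℝ} (ht : t ∈ Set.Icc a b)
    {x : E} (hx : T x = (t : ℂ) • x) : x ∈ bandSubspace H a b :=
  Submodule.subset_span ⟨htop ▸ Submodule.mem_top, t, ht, by rw [hHT, hx]⟩

/-! ### Linking the unbounded formulation to the bounded operator -/

section BoundedOperator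

variable {E : Type*} [NormedAddCommGroup E] [InnerProductSpace ℂ E] [CompleteSpace E]

/-- A self-adjoint operator with bounded numerical range is a bounded operator, represented by its
spectral measure. -/
theorem exists_clm_spectralPVM {H : E →ₗ.[ℂ] E} (hH : IsSelfAdjoint H) {Emin Emax : ℝ}
    (hE : ∀ x : H.domain, Emin * ‖(x : E)‖ ^ 2 ≤ (⟪(x : E), H x⟫_ℂ).re ∧
      (⟪(x : E), H x⟫_ℂ).re ≤ Emax * ‖(x : E)‖ ^ 2) :
    ∃ T : E →L[ℂ] E, IsSelfAdjoint T ∧ H.domain = ⊤ ∧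
      (∀ (x : E) (hx : x ∈ H.domain), H ⟨x, hx⟩ = T x) ∧
      (∀ x, Integrable (fun t : ℝ => t) ((spectralPVM H).scalarMeasure x)) ∧
      ∀ x, ⟪x, T x⟫_ℂ = ((∫ t, t ∂(spectralPVM H).scalarMeasure x : ℝ) : ℂ) := by
  obtain ⟨T, hT, htop, hHT⟩ := LinearPMap.exists_clm_of_numericalRange hH hE
  have hmem : ∀ x, x ∈ H.domain := fun x => htop ▸ Submodule.mem_top
  have hex : ∃ P, IsSpectralIntegral H P := by
    obtain ⟨P, hP⟩ := ContinuousLinearMap.exists_projValuedMeasure hT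
    refine ⟨P, fun x => ⟨fun _ => (hP x).1, fun _ => hmem x⟩, fun x => ?_⟩
    rw [hHT x x.2]
    exact (hP x).2
  have hspec : IsSpectralIntegral H (spectralPVM H) := Classical.epsilon_spec hex
  refine ⟨T, hT, htop, hHT, fun x => ?_, fun x => ?_⟩
  · have h2 := (hspec.1 x).mp (hmem x)
    -- First moments follow from second moments by `|t| ≤ t² + 1` and finite mass.
    refine Integrable.mono' (h2.add (integrable_const 1)) measurable_id.aestronglyMeasurable
      (.of_forall fun t => ?_)
    rw [Real.norm_eq_abs, abs_le]
    simp only [Pi.add_apply]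
    constructor <;> nlinarith [sq_nonneg (t + 1), sq_nonneg (t - 1)]
  · rw [← hHT x (hmem x)]
    exact hspec.2 ⟨x, hmem x⟩

variable {H : E →ₗ.[ℂ] E} {T : E →L[ℂ] E}

theorem sesqForm_eq_inner
    (hq : ∀ x, ⟪x, T x⟫_ℂ = ((∫ t, t ∂(spectralPVM H).scalarMeasure x : ℝ) : ℂ)) (x y : E) :
    sesqForm H x y = ⟪x, T y⟫_ℂ := by
  have h : ∀ z, ((quadForm H z : ℝ) : ℂ) = ⟪z, T z⟫_ℂ := fun z => (hq z).symm
  simp only [sesqForm, h, map_add, map_sub, map_smul, inner_add_left, inner_add_right,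
    inner_sub_left, inner_sub_right, inner_smul_left, inner_smul_right, Complex.conj_I]
  linear_combination (-(1 / 2) * ⟪x, T y⟫_ℂ + (1 / 2) * ⟪y, T x⟫_ℂ) * Complex.I_sq

/-- An eigenvector with eigenvalue outside `[a,b]` is orthogonal to all generators of the band;
lying in the band, it would be orthogonal to itself. -/
theorem eigenvalue_mem_Icc_of_mem_bandSubspace (hT : IsSelfAdjoint T)
    (hHT : ∀ (x : E) (hx : x ∈ H.domain), H ⟨x, hx⟩ = T x) {a b l : ℝ} {e : E}
    (he : T e = (l : ℂ) • e) (he0 : e ≠ 0) (hmem : e ∈ bandSubspace H a b) : l ∈ Set.Icc a b := by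
  by_contra hl
  have hsymm : ∀ x y, ⟪T x, y⟫_ℂ = ⟪x, T y⟫_ℂ :=
    ContinuousLinearMap.isSelfAdjoint_iff_isSymmetric.mp hT
  have horth : ∀ y ∈ bandSubspace H a b, ⟪y, e⟫_ℂ = 0 := by
    intro y hy
    induction hy using Submodule.span_induction with
    | mem y hy =>
      obtain ⟨hyd, t, ht, hyt⟩ := hy
      rw [hHT] at hyt
      have h1 := hsymm y e
      rw [hyt, he, inner_smul_left, inner_smul_right, Complex.conj_ofReal] at h1
      by_contra h0
      have h2 : t = l := by exact_mod_cast mul_right_cancel₀ h0 h1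
      exact hl (h2 ▸ ht)
    | zero => exact inner_zero_left _
    | add y z _ _ h1 h2 => rw [inner_add_left, h1, h2, add_zero]
    | smul c y _ h1 => rw [inner_smul_left, h1, mul_zero]
  exact he0 (inner_self_eq_zero.mp (horth e hmem))

/-- For `t` in `[a,b]`, `P({t}) n` is in the band, hence orthogonal to `n`, so it vanishes. Thus
`P([a,b]) n` has no atoms and the hypothesis on continuous spectrum applies. -/
theorem scalarMeasure_Icc_eq_zero_of_mem_orthogonal (hT : IsSelfAdjoint T) (htop : H.domain = ⊤)
    (hHT : ∀ (x : E) (hx : x ∈ H.domain), H ⟨x, hx⟩ = T x)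
    (hint : ∀ x, Integrable (fun t : ℝ => t) ((spectralPVM H).scalarMeasure x))
    (hq : ∀ x, ⟪x, T x⟫_ℂ = ((∫ t, t ∂(spectralPVM H).scalarMeasure x : ℝ) : ℂ))
    {a b : ℝ} (hcont : NoContinuousSpectrumOn H a b) {n : E} (hn : n ∈ (bandSubspace H a b)ᗮ) :
    (spectralPVM H).scalarMeasure n (Set.Icc a b) = 0 := by
  have h := hcont ((spectralPVM H).proj (Set.Icc a b) n) fun t => ?_
  · rwa [ProjValuedMeasure.scalarMeasure_proj _ measurableSet_Icc,
      Measure.restrict_apply measurableSet_Icc, Set.inter_self] at h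
  have hmt := measurableSet_singleton t
  rw [ProjValuedMeasure.scalarMeasure_proj _ measurableSet_Icc, Measure.restrict_apply hmt]
  by_cases ht : t ∈ Set.Icc a b
  · refine measure_mono_null Set.inter_subset_left ?_
    have hmem := mem_bandSubspace htop hHT ht
      (ProjValuedMeasure.apply_proj_singleton hT hint hq t n)
    have h0 := (Submodule.mem_orthogonal' _ _).mp hn _ hmem
    rw [((spectralPVM H).isStarProjection _ hmt).inner_apply_self] at h0
    rw [ProjValuedMeasure.scalarMeasure_apply _ hmt, Complex.ofReal_eq_zero.mp h0,
      ENNReal.ofReal_zero]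
  · rw [Set.singleton_inter_eq_empty.mpr ht, measure_empty]

end BoundedOperator

/-! ### The eigenvalue bounds -/

open scoped Matrix in
theorem mainTheorem6 {E : Type*} [NormedAddCommGroup E] [InnerProductSpace ℂ E] [CompleteSpace E]
    (H : E →ₗ.[ℂ] E) (hdense : Dense (H.domain : Set E)) (hH : IsSelfAdjoint H)
    (a b : ℝ) (m : ℕ)
    [FiniteDimensional ℂ (bandSubspace H a b)]
    (hm : Module.finrank ℂ (bandSubspace H a b) = m)
    -- trial vectors and the perturbed problem `[A, B]`
    (v : Fin m → E) (hv : ∀ i, v i ∈ formDomain H)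
    (A B δA δB NB : Matrix (Fin m) (Fin m) ℂ)
    (hδA : δA.IsHermitian) (hδB : δB.IsHermitian)
    (hA : A = formMatrix H v + δA) (hB : B = Matrix.gram ℂ v + δB)
    (hBpos : B.PosDef)
    -- the noise weight `N† N + δB`
    (hNB : NB = Matrix.gram ℂ (noise (bandSubspace H a b) v) + δB)
    -- the eigenvalues of `H` in the band and of `[A, B]`, in decreasing order
    (lam lamT : Fin m → ℝ)
    (hlam : IsEigenvaluesIn H (bandSubspace H a b) lam)
    (hlamT : IsGenEigenvalues A B lamT)
    -- the numerical range of `H` is contained in `[Emin, Emax]`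
    (Emin Emax : ℝ)
    (hE : ∀ x : H.domain, Emin * ‖(x : E)‖ ^ 2 ≤ (inner ℂ (x : E) (H x)).re ∧
      (inner ℂ (x : E) (H x)).re ≤ Emax * ‖(x : E)‖ ^ 2)
    -- the problem is well-conditioned
    (hwell : eigMax NB < eigMin B)
    (hcont : NoContinuousSpectrumOn H a b) :
    ∀ i : Fin m,
      (Emin ≤ lamT i ∨ a ≤ Emin →
        ((Emin - lamT i) *
            matrixOpNorm (spectralMatrix H (noise (bandSubspace H a b) v) (Set.Iio a))
          + eigMinStar (δA - (lamT i : ℂ) • δB)) / (eigMin B - eigMax NB)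
          ≤ lamT i - lam i) ∧
      (lamT i ≤ Emax ∨ Emax ≤ b →
        lamT i - lam i ≤
        ((Emax - lamT i) *
            matrixOpNorm (spectralMatrix H (noise (bandSubspace H a b) v) (Set.Ioi b))
          + eigMaxStar (δA - (lamT i : ℂ) • δB)) / (eigMin B - eigMax NB)) := by
  obtain ⟨T, hT, htop, hHT, hint, hq⟩ := exists_clm_spectralPVM hH hE
  have hsymm : (T : E →ₗ[ℂ] E).IsSymmetric :=
    ContinuousLinearMap.isSelfAdjoint_iff_isSymmetric.mp hT
  have hmem : ∀ x, x ∈ H.domain := fun x => htop ▸ Submodule.mem_top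
  have hEmin : ∀ x, Emin * ‖x‖ ^ 2 ≤ (⟪x, T x⟫_ℂ).re := fun x => by
    rw [← hHT x (hmem x)]; exact (hE ⟨x, hmem x⟩).1
  have hEmax : ∀ x, (⟪x, T x⟫_ℂ).re ≤ Emax * ‖x‖ ^ 2 := fun x => by
    rw [← hHT x (hmem x)]; exact (hE ⟨x, hmem x⟩).2
  set K := bandSubspace H a b with hK
  obtain ⟨hanti, e, he, hspan, heig⟩ := hlam
  obtain ⟨hantiT, c, hc, hgen⟩ := hlamT
  have hTe : ∀ k, T (e k) = (lam k : ℂ) • e k := fun k => by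
    obtain ⟨hk, h⟩ := heig k
    rwa [hHT] at h
  have heK : ∀ k, e k ∈ K := fun k => hspan ▸ Submodule.subset_span ⟨k, rfl⟩
  have hlamIcc : ∀ k, lam k ∈ Set.Icc a b := fun k =>
    eigenvalue_mem_Icc_of_mem_bandSubspace hT hHT (hTe k) (he.ne_zero k) (heK k)
  have hform : formMatrix H v = Matrix.of fun i j => ⟪v i, (T : E →ₗ[ℂ] E) (v j)⟫_ℂ := by
    ext i j
    exact sesqForm_eq_inner hq _ _
  have hformH : (formMatrix H v).IsHermitian := by
    rw [hform]
    ext i j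
    simp only [Matrix.conjTranspose_apply, Matrix.of_apply]
    rw [← hsymm, ← inner_conj_symm, starRingEnd_apply, star_star]
  have hAH : A.IsHermitian := hA ▸ hformH.add hδA
  have hNBH : NB.IsHermitian := hNB ▸ (Matrix.isHermitian_gram ℂ _).add hδB
  -- the trial vector, its band coordinates and its noise
  let V : (Fin m → ℂ) →ₗ[ℂ] E := Fintype.linearCombination ℂ v
  let y : (Fin m → ℂ) →ₗ[ℂ] (Fin m → ℂ) :=
    LinearMap.pi fun k => (innerSL ℂ (e k) : E →ₗ[ℂ] ℂ) ∘ₗ V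
  let n : (Fin m → ℂ) → E := fun x => Kᗮ.starProjection (V x)
  have hnK : ∀ x, n x ∈ Kᗮ := fun x => Submodule.starProjection_apply_mem _ _
  have hen : ∀ x k, ⟪e k, n x⟫_ℂ = 0 := fun x k =>
    (Submodule.mem_orthogonal _ _).mp (hnK x) _ (heK k)
  have hsplit : ∀ x, V x = ∑ k, y x k • e k + n x := by
    intro x
    have h1 : K.starProjection (V x) = ∑ k, y x k • e k := by
      refine (Submodule.eq_starProjection_of_mem_of_inner_eq_zero
        (Submodule.sum_mem _ fun k _ => K.smul_mem _ (heK k)) fun w hw => ?_)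
      rw [← hspan] at hw
      induction hw using Submodule.span_induction with
      | mem w hw =>
        obtain ⟨k, rfl⟩ := hw
        have h2 : ⟪e k, V x - ∑ k, y x k • e k⟫_ℂ = 0 := by
          rw [inner_sub_right, he.inner_right_fintype, sub_eq_zero]
          rfl
        rw [← inner_conj_symm, h2, map_zero]
      | zero => exact inner_zero_right _
      | add w w' _ _ h1 h2 => rw [inner_add_right, h1, h2, add_zero]
      | smul c w _ h1 => rw [inner_smul_right, h1, mul_zero]
    rw [← h1]
    exact (K.starProjection_add_starProjection_orthogonal (V x)).symm
  have hnoise : ∀ x, n x = ∑ i, x i • noise K v i := by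
    intro x
    simp only [n, V, Fintype.linearCombination_apply, map_sum, map_smul, noise]
  have hgramB : ∀ x, (star x ⬝ᵥ Matrix.gram ℂ v *ᵥ x).re = ‖V x‖ ^ 2 := by
    intro x
    have h := star_dotProduct_of_inner_mulVec LinearMap.id v x
    have h1 : Matrix.gram ℂ v = Matrix.of fun i j => ⟪v i, LinearMap.id (R := ℂ) (v j)⟫_ℂ := rfl
    rw [h1, h, LinearMap.id_apply]
    exact inner_self_eq_norm_sq (𝕜 := ℂ) (V x)
  have hgramN : ∀ x, (star x ⬝ᵥ Matrix.gram ℂ (noise K v) *ᵥ x).re = ‖n x‖ ^ 2 := by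
    intro x
    have h := star_dotProduct_of_inner_mulVec LinearMap.id (noise K v) x
    have h1 : Matrix.gram ℂ (noise K v)
        = Matrix.of fun i j => ⟪noise K v i, LinearMap.id (R := ℂ) (noise K v j)⟫_ℂ := rfl
    rw [h1, h, LinearMap.id_apply, ← hnoise]
    exact inner_self_eq_norm_sq (𝕜 := ℂ) (n x)
  have hspecN : ∀ x I, MeasurableSet I →
      ‖(spectralPVM H).proj I (n x)‖ ^ 2 ≤
        matrixOpNorm (spectralMatrix H (noise K v) I) * ∑ i, ‖x i‖ ^ 2 := by
    intro x I hI
    refine le_trans (le_of_eq ?_) (re_dotProduct_mulVec_le_matrixOpNorm _ x)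
    have h := star_dotProduct_of_inner_mulVec ((spectralPVM H).proj I : E →ₗ[ℂ] E) (noise K v) x
    rw [← hnoise] at h
    simp only [ContinuousLinearMap.coe_coe] at h
    rw [spectralMatrix, h, ((spectralPVM H).isStarProjection I hI).inner_apply_self,
      Complex.ofReal_re]
  have hg : 0 < eigMin B - eigMax NB := sub_pos.mpr hwell
  -- The perturbation `δB` occurs in both `B` and `NB` and cancels in the difference of their forms,
  -- leaving `‖V x‖² - ‖n x‖²`.
  have hcond : ∀ x, (eigMin B - eigMax NB) * ∑ i, ‖x i‖ ^ 2 ≤ ∑ k, ‖y x k‖ ^ 2 := by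
    intro x
    have h1 := eigMin_le_re_dotProduct_mulVec hBpos.isHermitian x
    have h2 := re_dotProduct_mulVec_le_eigMax hNBH x
    have h3 := he.norm_sum_add_sq (y x) (hen x)
    rw [← hsplit] at h3
    rw [hB, Matrix.add_mulVec, dotProduct_add, Complex.add_re, hgramB, ← hB] at h1
    rw [hNB, Matrix.add_mulVec, dotProduct_add, Complex.add_re, hgramN, ← hNB] at h2
    linarith
  have hquad : ∀ (s : ℝ) x, (star x ⬝ᵥ (A - (s : ℂ) • B) *ᵥ x).re
      = ∑ k, (lam k - s) * ‖y x k‖ ^ 2 + ((⟪n x, T (n x)⟫_ℂ).re - s * ‖n x‖ ^ 2)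
        + (star x ⬝ᵥ (δA - (s : ℂ) • δB) *ᵥ x).re := by
    intro s x
    have h1 : A - (s : ℂ) • B
        = formMatrix H v - (s : ℂ) • Matrix.gram ℂ v + (δA - (s : ℂ) • δB) := by
      rw [hA, hB, smul_add]; abel
    have h2 := star_dotProduct_of_inner_mulVec (T : E →ₗ[ℂ] E) v x
    have h3 := Orthonormal.re_inner_apply_sum_add hsymm he hTe (y x) (hen x)
    have h4 := he.norm_sum_add_sq (y x) (hen x)
    rw [← hsplit] at h3 h4
    have h5 : (star x ⬝ᵥ formMatrix H v *ᵥ x).re = (⟪V x, T (V x)⟫_ℂ).re := by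
      rw [hform, h2]; rfl
    rw [h1, Matrix.add_mulVec, Matrix.sub_mulVec, Matrix.smul_mulVec, dotProduct_add,
      dotProduct_sub, dotProduct_smul, Complex.add_re, Complex.sub_re, smul_eq_mul,
      Complex.re_ofReal_mul, hgramB, h5, h4]
    have h6 : (⟪V x, T (V x)⟫_ℂ).re = ∑ k, lam k * ‖y x k‖ ^ 2 + (⟪n x, T (n x)⟫_ℂ).re := h3
    rw [h6]
    simp only [sub_mul, Finset.sum_sub_distrib, ← Finset.mul_sum]
    ring
  have hxpos : ∀ x : Fin m → ℂ, x ≠ 0 → 0 < ∑ i, ‖x i‖ ^ 2 := by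
    intro x hx
    obtain ⟨j, hj⟩ := Function.ne_iff.mp hx
    exact Finset.sum_pos' (fun _ _ => sq_nonneg _)
      ⟨j, Finset.mem_univ _, pow_pos (norm_pos_iff.mpr hj) 2⟩
  have hscalar : ∀ x, (spectralPVM H).scalarMeasure (n x) (Set.Icc a b) = 0 := fun x =>
    scalarMeasure_Icc_eq_zero_of_mem_orthogonal hT htop hHT hint hq hcont (hnK x)
  have hop : ∀ M : Matrix (Fin m) (Fin m) ℂ, 0 ≤ matrixOpNorm M := fun M => norm_nonneg _
  have hδ : ∀ s : ℝ, (δA - (s : ℂ) • δB).IsHermitian := fun s =>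
    hδA.sub (by
      rw [Matrix.IsHermitian, Matrix.conjTranspose_smul, hδB.eq, Complex.star_def,
        Complex.conj_ofReal])
  have hlamE : ∀ k, Emin ≤ lam k ∧ lam k ≤ Emax := by
    intro k
    have h1 := hEmin (e k)
    have h2 := hEmax (e k)
    rw [hTe, inner_smul_right, inner_self_eq_norm_sq_to_K, he.1 k] at h1 h2
    simpa using And.intro h1 h2
  have hzero : ∀ {I : Set ℝ}, MeasurableSet I →
      (∀ w, (spectralPVM H).scalarMeasure w I = 0) →
      matrixOpNorm (spectralMatrix H (noise K v) I) = 0 ∧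
        ∀ w, (spectralPVM H).proj I w = 0 := by
    intro I hI h
    have h1 : ∀ w, (spectralPVM H).proj I w = 0 := fun w => by
      have h2 := (spectralPVM H).scalarMeasure_real hI w
      rw [measureReal_def, h w, ENNReal.toReal_zero] at h2
      simpa using h2.symm
    refine ⟨?_, h1⟩
    have h3 : spectralMatrix H (noise K v) I = 0 := by
      ext i j
      simp [spectralMatrix, h1]
    rw [h3, matrixOpNorm, map_zero, norm_zero]
  intro i
  constructor
  · intro hcase
    set s := lamT i with hs
    set D := δA - (s : ℂ) • δB with hD
    set W := matrixOpNorm (spectralMatrix H (noise K v) (Set.Iio a)) with hW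
    rw [div_le_iff₀ hg]
    -- If `s` lies above the band, the left side is nonpositive and `lam i ≤ b < s`, so the bound is
    -- trivial. The integral estimate needs `s ≤ b`.
    by_cases hsb : b < s
    · have h1 : Emin ≤ s := by
        have := (hlamE i).1
        have := (hlamIcc i).2
        linarith
      have h2 : (Emin - s) * W ≤ 0 := mul_nonpos_of_nonpos_of_nonneg (by linarith) (hop _)
      have h3 : eigMinStar D ≤ 0 := min_le_right _ _
      have h4 : 0 ≤ (s - lam i) * (eigMin B - eigMax NB) :=
        mul_nonneg (by linarith [(hlamIcc i).2]) hg.le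
      linarith
    rw [not_lt] at hsb
    -- Inserting the operator norm requires `Emin - s ≤ 0`. Otherwise `a ≤ Emin`, and there is no
    -- spectral mass below `a` at all.
    have hW0 : (Emin - s) * W ≤ 0 ∧ ∀ x, (Emin - s) * (W * ∑ i, ‖x i‖ ^ 2)
        ≤ (Emin - s) * ‖(spectralPVM H).proj (Set.Iio a) (n x)‖ ^ 2 := by
      rcases le_or_gt Emin s with hsE | hsE
      · exact ⟨mul_nonpos_of_nonpos_of_nonneg (by linarith) (hop _), fun x =>
          mul_le_mul_of_nonpos_left (hspecN x _ measurableSet_Iio) (by linarith)⟩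
      · have hEa : a ≤ Emin := hcase.resolve_left (not_le.mpr hsE)
        have hz := hzero measurableSet_Iio fun w => measure_mono_null (Set.Iio_subset_Iio hEa)
          (ProjValuedMeasure.scalarMeasure_Iio_eq_zero hint hq hEmin w)
        simp [hW, hz.1, hz.2]
    have hR : ∀ x, ((Emin - s) * W + eigMinStar D) * ∑ i, ‖x i‖ ^ 2
        ≤ ((⟪n x, T (n x)⟫_ℂ).re - s * ‖n x‖ ^ 2) + (star x ⬝ᵥ D *ᵥ x).re := by
      intro x
      have h1 := ProjValuedMeasure.le_inner_apply_sub hint hq hEmin hsb (hscalar x)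
      have h2 := hW0.2 x
      have h3 := eigMin_le_re_dotProduct_mulVec (hδ s) x
      have h4 : eigMinStar D * ∑ i, ‖x i‖ ^ 2 ≤ eigMin D * ∑ i, ‖x i‖ ^ 2 :=
        mul_le_mul_of_nonneg_right (min_le_left _ _)
          (Finset.sum_nonneg fun _ _ => sq_nonneg _)
      linarith
    have hR0 : (Emin - s) * W + eigMinStar D ≤ 0 := add_nonpos hW0.1 (min_le_right _ _)
    -- The eigenvectors from index `i` on outnumber the coordinates after `i` by exactly one.
    obtain ⟨z, hzJ, hx0, hyk⟩ := exists_combination_of_card_lt hc y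
      (J := Finset.Ici i) (K := Finset.Ioi i) (by simp; omega)
    set x := ∑ j, z j • c j with hx
    have h0 : (star x ⬝ᵥ (A - (s : ℂ) • B) *ᵥ x).re ≤ 0 :=
      re_dotProduct_nonpos_of_genEigenvectors hAH hBpos.posSemidef hgen
        fun j hj => hantiT (Finset.mem_Ici.mp (hzJ j hj))
    rw [hquad] at h0
    have h1 : (lam i - s) * ∑ k, ‖y x k‖ ^ 2 ≤ ∑ k, (lam k - s) * ‖y x k‖ ^ 2 := by
      rw [Finset.mul_sum]
      refine Finset.sum_le_sum fun k _ => ?_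
      rcases lt_or_ge i k with hk | hk
      · simp [hyk k (Finset.mem_Ioi.mpr hk)]
      · exact mul_le_mul_of_nonneg_right (by linarith [hanti hk]) (sq_nonneg _)
    have h2 := hR x
    have h3 := hcond x
    have h4 := hxpos x hx0
    by_contra hneg
    rw [not_le] at hneg
    -- The remainder constant is nonpositive, so failure of the bound forces this sign. Only then
    -- can `hcond` be multiplied by `lam i - s`.
    have h5 : 0 < lam i - s :=
      pos_of_mul_pos_left (b := eigMin B - eigMax NB) (by nlinarith) hg.le
    have h6 := mul_le_mul_of_nonneg_left h3 h5.le
    have h7 := mul_lt_mul_of_pos_right hneg h4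
    nlinarith
  · intro hcase
    set s := lamT i with hs
    set D := δA - (s : ℂ) • δB with hD
    set W := matrixOpNorm (spectralMatrix H (noise K v) (Set.Ioi b)) with hW
    rw [le_div_iff₀ hg]
    -- Mirror image: below the band the bound is a matter of signs.
    by_cases hsa : s < a
    · have h1 : s ≤ Emax := by
        have := (hlamE i).2
        have := (hlamIcc i).1
        linarith
      have h2 : 0 ≤ (Emax - s) * W := mul_nonneg (by linarith) (hop _)
      have h3 : 0 ≤ eigMaxStar D := le_max_right _ _
      have h4 : (s - lam i) * (eigMin B - eigMax NB) ≤ 0 :=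
        mul_nonpos_of_nonpos_of_nonneg (by linarith [(hlamIcc i).1]) hg.le
      linarith
    rw [not_lt] at hsa
    have hW0 : 0 ≤ (Emax - s) * W ∧ ∀ x, (Emax - s) * ‖(spectralPVM H).proj (Set.Ioi b) (n x)‖ ^ 2
        ≤ (Emax - s) * (W * ∑ i, ‖x i‖ ^ 2) := by
      rcases le_or_gt s Emax with hsE | hsE
      · exact ⟨mul_nonneg (by linarith) (hop _), fun x =>
          mul_le_mul_of_nonneg_left (hspecN x _ measurableSet_Ioi) (by linarith)⟩
      · have hEb : Emax ≤ b := hcase.resolve_left (not_le.mpr hsE)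
        have hz := hzero measurableSet_Ioi fun w => measure_mono_null (Set.Ioi_subset_Ioi hEb)
          (ProjValuedMeasure.scalarMeasure_Ioi_eq_zero hint hq hEmax w)
        simp [hW, hz.1, hz.2]
    have hR : ∀ x, ((⟪n x, T (n x)⟫_ℂ).re - s * ‖n x‖ ^ 2) + (star x ⬝ᵥ D *ᵥ x).re
        ≤ ((Emax - s) * W + eigMaxStar D) * ∑ i, ‖x i‖ ^ 2 := by
      intro x
      have h1 := ProjValuedMeasure.inner_apply_sub_le hint hq hEmax hsa (hscalar x)
      have h2 := hW0.2 x
      have h3 := re_dotProduct_mulVec_le_eigMax (hδ s) x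
      have h4 : eigMax D * ∑ i, ‖x i‖ ^ 2 ≤ eigMaxStar D * ∑ i, ‖x i‖ ^ 2 :=
        mul_le_mul_of_nonneg_right (le_max_left _ _)
          (Finset.sum_nonneg fun _ _ => sq_nonneg _)
      linarith
    have hR0 : 0 ≤ (Emax - s) * W + eigMaxStar D := add_nonneg hW0.1 (le_max_right _ _)
    -- Here the eigenvectors up to index `i` outnumber the coordinates strictly before `i` by one.
    obtain ⟨z, hzJ, hx0, hyk⟩ := exists_combination_of_card_lt hc y
      (J := Finset.Iic i) (K := Finset.Iio i) (by simp)
    set x := ∑ j, z j • c j with hx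
    have h0 : 0 ≤ (star x ⬝ᵥ (A - (s : ℂ) • B) *ᵥ x).re :=
      re_dotProduct_nonneg_of_genEigenvectors hAH hBpos.posSemidef hgen
        fun j hj => hantiT (Finset.mem_Iic.mp (hzJ j hj))
    rw [hquad] at h0
    have h1 : ∑ k, (lam k - s) * ‖y x k‖ ^ 2 ≤ (lam i - s) * ∑ k, ‖y x k‖ ^ 2 := by
      rw [Finset.mul_sum]
      refine Finset.sum_le_sum fun k _ => ?_
      rcases lt_or_ge k i with hk | hk
      · simp [hyk k (Finset.mem_Iio.mpr hk)]
      · exact mul_le_mul_of_nonneg_right (by linarith [hanti hk]) (sq_nonneg _)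
    have h2 := hR x
    have h3 := hcond x
    have h4 := hxpos x hx0
    by_contra hneg
    rw [not_le] at hneg
    have h5 : 0 < s - lam i := pos_of_mul_pos_left (hR0.trans_lt hneg) hg.le
    have h6 := mul_le_mul_of_nonneg_left h3 h5.le
    have h7 := mul_lt_mul_of_pos_right hneg h4
    nlinarith
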